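/- Let $(M,\eta)$ be a smooth pseudo-Riemannian manifold of dimension $m$ with Levi-Civita connection $\bar\nabla$, Christoffel symbols $\bar\Gamma^i_{jk}$ and curvature tensor $\bar R(X,Y)Z=\bar\nabla_X\bar\nabla_YZ-\bar\nabla_Y\bar\nabla_XZ-\bar\nabla_{[X,Y]}Z$. Let $\Sigma$ be an (embedded or, more generally, immersed) smooth $n$-dimensional submanifold of $M$ whose induced metric $g$ is nondegenerate, with local coordinates $u^1,\dots,u^n$ on $\Sigma$, local coordinates $x^1,\dots,x^m$ on $M$, and $g_{ab}=\eta(e_a,e_b)$, $e_a=(\partial_ax^i)\partial_i$. Let $r\ge 0$ and let $\{\cdot,\dots,\cdot\}:C^\infty(\Sigma)^{r+1}\to C^\infty(\Sigma)$ be an $\mathbb R$-multilinear map that satisfies the Leibniz rule in every argument (and therefore also acts on functions defined locally, such as $x^i$). For a multi-index $I=(i_1,\dots,i_r)$ put $\{f,\vec x^I\}=\{f,x^{i_1},\dots,x^{i_r}\}$, $\mathcal P^{iI}=\frac1{\sqrt{r!}}\{x^i,\vec x^I\}$ and $\eta_{IJ}=\eta_{i_1j_1}\cdots\eta_{i_rj_r}$,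 and assume that there are $\epsilon\in\{-1,1\}$ and $0<\gamma\in C^\infty(\Sigma)$ with $$\mathcal P^{iI}\mathcal P^{jJ}\eta_{IJ}=\epsilon\gamma^2g^{ab}(\partial_ax^i)(\partial_bx^j)$$ in all local coordinates. Define $$\mathcal D^{ij}=\frac{\epsilon}{\gamma^2}\mathcal P^{iI}\mathcal P^{jJ}\eta_{IJ},\qquad \mathcal D^i(f)=\frac{\epsilon}{\gamma^2r!}\{x^i,\vec x^I\}\{f,\vec x^J\}\eta_{IJ},\qquad \hat\nabla^jV^i=\mathcal D^j(V^i)+\mathcal D^{jl}\bar\Gamma^i_{lk}V^k$$ for vector fields $V=V^i\partial_i$ of $M$ along $\Sigma$, put $\hat\nabla_XV=X_j(\hat\nabla^jV^i)\partial_i$, and extend $\hat\nabla^k$ to contravariant two-tensors along $\Sigma$ by $\hat\nabla^kT^{ij}=\mathcal D^k(T^{ij})+\mathcal D^{kl}(\bar\Gamma^i_{ls}T^{sj}+\bar\Gamma^j_{ls}T^{is})$. For a normal field $N$ put $\mathcal B_N^{ij}=-\hat\nabla^iN^j$, $\mathcal B_N(V)=\mathcal B_N^{ij}\eta_{jk}V^k\partial_i$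 and $(\hat\nabla_X\mathcal B_N)(V)=\hat\nabla_X(\mathcal B_N(V))-\mathcal B_N(\hat\nabla_XV)$. For $X,Y$ tangent and $\xi$ normal to $\Sigma$ let $\nabla_XY$ and $\alpha(X,Y)$ be the tangential and normal components of $\bar\nabla_XY$, let $D_X\xi$ be the normal component of $\bar\nabla_X\xi$, and put $(\widetilde\nabla_X\alpha)(Y,Z)=D_X\alpha(Y,Z)-\alpha(\nabla_XY,Z)-\alpha(Y,\nabla_XZ)$. Then for all smooth vector fields $X,Y,Z$ tangent to $\Sigma$ and $N$ normal to $\Sigma$, at every point of $\Sigma$ and in all local coordinates around it, $$\eta\big(\bar R(X,Y)Z,N\big)=X_iY_jZ_l\big(\hat\nabla^i\mathcal B_N^{jl}-\hat\nabla^j\mathcal B_N^{il}\big)=\eta\big((\hat\nabla_X\mathcal B_N)(Z),Y\big)-\eta\big((\hat\nabla_Y\mathcal B_N)(Z),X\big),$$ and these also equal the classical expression $$\eta\big((\widetilde\nabla_X\alpha)(Y,Z)-(\widetilde\nabla_Y\alpha)(X,Z),N\big).$$ -/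

import Mathlib

open scoped Manifold ContDiff Topology

noncomputable section

namespace PseudoSub

/-! ## The ambient pseudo-Riemannian manifold -/

/-- A smooth pseudo-Riemannian metric on a manifold `M` of dimension `m`: a smooth field of
symmetric nondegenerate bilinear forms on the tangent spaces. -/
structure PseudoMetric {m : ℕ} (M : Type*) [TopologicalSpace M]
    [ChartedSpace (EuclideanSpace ℝ (Fin m)) M] [IsManifold (𝓡 m) ∞ M] where
  /-- the bilinear form on the tangent space at `q` -/
  form (q : M) : TangentSpace (𝓡 m) q →L[ℝ] TangentSpace (𝓡 m) q →L[ℝ] ℝ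
  symm (q : M) (v w : TangentSpace (𝓡 m) q) : form q v w = form q w v
  nondegenerate (q : M) (v : TangentSpace (𝓡 m) q) (hv : ∀ w, form q v w = 0) : v = 0
  contMDiff : ContMDiff (𝓡 m)
    ((𝓡 m).prod 𝓘(ℝ, EuclideanSpace ℝ (Fin m) →L[ℝ] EuclideanSpace ℝ (Fin m) →L[ℝ] ℝ)) ∞
    (fun q ↦ Bundle.TotalSpace.mk'
      (EuclideanSpace ℝ (Fin m) →L[ℝ] EuclideanSpace ℝ (Fin m) →L[ℝ] ℝ) q (form q))

section Ambient

variable {m : ℕ} {M : Type*} [TopologicalSpace M]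
  [ChartedSpace (EuclideanSpace ℝ (Fin m)) M]

/-- The partial derivative `∂ₖ f` of a function `f` in the local coordinates of the chart `ψ`. -/
def pd (ψ : OpenPartialHomeomorph M (EuclideanSpace ℝ (Fin m))) (k : Fin m) (f : M → ℝ) (q : M) :
    ℝ :=
  fderiv ℝ (fun y ↦ f (ψ.symm y)) (ψ q) (EuclideanSpace.single k 1)

/-- The coordinate vector `∂ₖ` of the chart `ψ` at a point `q` of its domain, as the value at
`ψ q` of the derivative of `ψ.symm`; its base point is `ψ.symm (ψ q)`, which is `q`. -/
def coordVec (ψ : OpenPartialHomeomorph M (EuclideanSpace ℝ (Fin m))) (k : Fin m) (q : M) :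
    TangentSpace (𝓡 m) (ψ.symm (ψ q)) :=
  mfderiv (𝓡 m) (𝓡 m) ψ.symm (ψ q) (EuclideanSpace.single k (1 : ℝ) : EuclideanSpace ℝ (Fin m))

variable [IsManifold (𝓡 m) ∞ M] (η : PseudoMetric (m := m) M)
  (ψ : OpenPartialHomeomorph M (EuclideanSpace ℝ (Fin m)))

/-- The components `η_{ij} = η(∂ᵢ, ∂ⱼ)`. -/
def metricMat (q : M) : Matrix (Fin m) (Fin m) ℝ :=
  Matrix.of fun i j ↦ η.form (ψ.symm (ψ q)) (coordVec ψ i q) (coordVec ψ j q)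

/-- The Christoffel symbols `Γ̄^i_{jk}` of the Levi-Civita connection of `η`. -/
def christoffel (i j k : Fin m) (q : M) : ℝ :=
  (1 / 2) * ∑ l, (metricMat η ψ q)⁻¹ i l *
    (pd ψ j (fun q' ↦ metricMat η ψ q' l k) q + pd ψ k (fun q' ↦ metricMat η ψ q' l j) q
      - pd ψ l (fun q' ↦ metricMat η ψ q' j k) q)

/-- The components of the curvature tensor `R̄(X,Y)Z = ∇̄_X ∇̄_Y Z - ∇̄_Y ∇̄_X Z - ∇̄_{[X,Y]} Z`:
`R̄(∂ᵢ, ∂ⱼ) ∂ₖ = ∑ₗ curvature l k i j • ∂ₗ`. -/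
def curvature (l k i j : Fin m) (q : M) : ℝ :=
  pd ψ i (christoffel η ψ l j k) q - pd ψ j (christoffel η ψ l i k) q
    + ∑ p, (christoffel η ψ l i p q * christoffel η ψ p j k q
      - christoffel η ψ l j p q * christoffel η ψ p i k q)

/-- `η(V, W)` for vectors at `q` given by their components. -/
def ip (q : M) (V W : Fin m → ℝ) : ℝ :=
  ∑ i, ∑ j, metricMat η ψ q i j * V i * W j

/-- The covariant components `V_i = η_{ij} V^j`. -/
def lower (q : M) (V : Fin m → ℝ) (i : Fin m) : ℝ :=
  ∑ j, metricMat η ψ q i j * V j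

/-- The components of `R̄(X, Y) Z`. -/
def riemann (q : M) (X Y Z : Fin m → ℝ) (l : Fin m) : ℝ :=
  ∑ k, ∑ i, ∑ j, curvature η ψ l k i j q * X i * Y j * Z k

end Ambient

/-! ## Multi-linear brackets on the functions of a manifold -/

section Bracket

variable {n r : ℕ} {S : Type*} [TopologicalSpace S] [ChartedSpace (EuclideanSpace ℝ (Fin n)) S]

/-- The product rule in every argument. -/
def IsMultiDerivation (br : MultilinearMap ℝ (fun _ : Fin (r + 1) ↦ C^∞⟮𝓡 n, S; ℝ⟯)
    C^∞⟮𝓡 n, S; ℝ⟯) : Prop :=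
  ∀ (F : Fin (r + 1) → C^∞⟮𝓡 n, S; ℝ⟯) (k : Fin (r + 1)) (f g : C^∞⟮𝓡 n, S; ℝ⟯),
    br (Function.update F k (f * g)) =
      f * br (Function.update F k g) + g * br (Function.update F k f)

open Classical in
/-- The value at `p` of the bracket of functions that are only defined (and smooth) near `p`,
such as local coordinates: the bracket of smooth functions on `S` which agree with
the given ones near `p`. By `bracketAt_eq` the choice does not matter. -/
def bracketAt (br : MultilinearMap ℝ (fun _ : Fin (r + 1) ↦ C^∞⟮𝓡 n, S; ℝ⟯) C^∞⟮𝓡 n, S; ℝ⟯)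
    (f : Fin (r + 1) → S → ℝ) (p : S) : ℝ :=
  if h : ∃ F : Fin (r + 1) → C^∞⟮𝓡 n, S; ℝ⟯, ∀ k, (F k : S → ℝ) =ᶠ[𝓝 p] f k then
    br h.choose p
  else 0

theorem bracket_eq_zero [T2Space S] [IsManifold (𝓡 n) ∞ S]
    {br : MultilinearMap ℝ (fun _ : Fin (r + 1) ↦ C^∞⟮𝓡 n, S; ℝ⟯) C^∞⟮𝓡 n, S; ℝ⟯}
    (hbr : IsMultiDerivation br) (F : Fin (r + 1) → C^∞⟮𝓡 n, S; ℝ⟯) (k : Fin (r + 1)) (p : S)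
    (h : (F k : S → ℝ) =ᶠ[𝓝 p] 0) : br F p = 0 := by
  obtain ⟨χ, -, hχ⟩ := (SmoothBumpFunction.nhds_basis_tsupport (I := 𝓡 n) p).mem_iff.1 h
  let c : C^∞⟮𝓡 n, S; ℝ⟯ := ⟨fun x ↦ χ x, χ.contMDiff⟩
  have hc : c p = 1 := χ.eq_one
  have h1 : (1 - c) * F k = F k := by
    ext x
    by_cases hx : x ∈ tsupport χ
    · have : F k x = 0 := hχ hx
      simp [this]
    · have : c x = 0 := image_eq_zero_of_notMem_tsupport hx
      simp [this]
  have h2 := hbr F k (1 - c) (F k)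
  rw [h1, Function.update_eq_self] at h2
  have h3 := congrArg (fun G : C^∞⟮𝓡 n, S; ℝ⟯ ↦ G p) h2
  have h4 : F k p = 0 := h.self_of_nhds
  simpa [hc, h4] using h3

theorem bracket_congr [T2Space S] [IsManifold (𝓡 n) ∞ S]
    {br : MultilinearMap ℝ (fun _ : Fin (r + 1) ↦ C^∞⟮𝓡 n, S; ℝ⟯) C^∞⟮𝓡 n, S; ℝ⟯}
    (hbr : IsMultiDerivation br) (F G : Fin (r + 1) → C^∞⟮𝓡 n, S; ℝ⟯) (p : S)
    (h : ∀ k, (F k : S → ℝ) =ᶠ[𝓝 p] G k) : br F p = br G p := by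
  classical
  suffices H : ∀ s : Finset (Fin (r + 1)), br (s.piecewise G F) p = br F p by
    simpa using (H Finset.univ).symm
  intro s
  induction s using Finset.induction_on with
  | empty => simp
  | insert a s ha ih =>
    rw [← ih, Finset.piecewise_insert]
    set K := s.piecewise G F with hK
    have hKa : K a = F a := by simp [hK, ha]
    have e1 : G a = (G a - F a) + F a := by abel
    rw [e1, MultilinearMap.map_update_add]
    have e2 : br (Function.update K a (G a - F a)) p = 0 := by
      refine bracket_eq_zero hbr _ a p ?_
      filter_upwards [h a] with x hx
      simp [hx]
    have e3 : Function.update K a (F a) = K := by rw [← hKa, Function.update_eq_self]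
    rw [e3, ContMDiffMap.coe_add, Pi.add_apply, e2, zero_add]

theorem bracketAt_eq [T2Space S] [IsManifold (𝓡 n) ∞ S]
    {br : MultilinearMap ℝ (fun _ : Fin (r + 1) ↦ C^∞⟮𝓡 n, S; ℝ⟯) C^∞⟮𝓡 n, S; ℝ⟯}
    (hbr : IsMultiDerivation br) (f : Fin (r + 1) → S → ℝ) (F : Fin (r + 1) → C^∞⟮𝓡 n, S; ℝ⟯)
    (p : S) (h : ∀ k, (F k : S → ℝ) =ᶠ[𝓝 p] f k) : bracketAt br f p = br F p := by
  have hex : ∃ F : Fin (r + 1) → C^∞⟮𝓡 n, S; ℝ⟯, ∀ k, (F k : S → ℝ) =ᶠ[𝓝 p] f k := ⟨F, h⟩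
  rw [bracketAt, dif_pos hex]
  exact bracket_congr hbr _ _ p fun k ↦ (hex.choose_spec k).trans (h k).symm

end Bracket

/-! ## The submanifold -/

section Submanifold

variable {m n : ℕ} {M : Type*} [TopologicalSpace M] [ChartedSpace (EuclideanSpace ℝ (Fin m)) M]
  {S : Type*} [TopologicalSpace S] [ChartedSpace (EuclideanSpace ℝ (Fin n)) S]

/-- A smooth vector field of `M` along `ι`, that is, a smooth section of `TM` restricted to `S`. -/
def IsSmoothAlong (ι : S → M) (V : ∀ p : S, TangentSpace (𝓡 m) (ι p)) [IsManifold (𝓡 m) ∞ M] :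
    Prop :=
  ContMDiff (𝓡 n) (𝓡 m).tangent ∞ (fun p ↦ (⟨ι p, V p⟩ : TangentBundle (𝓡 m) M))

/-- `V` takes values in the tangent spaces of the submanifold, regarded as subspaces of those
of `M`. -/
def IsTangent (ι : S → M) (V : ∀ p : S, TangentSpace (𝓡 m) (ι p)) : Prop :=
  ∀ p, ∃ v : TangentSpace (𝓡 n) p, mfderiv (𝓡 n) (𝓡 m) ι p v = V p

/-- The components `V^i` of a vector field along `ι` in the chart `ψ`. -/
def comps (ι : S → M) (ψ : OpenPartialHomeomorph M (EuclideanSpace ℝ (Fin m)))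
    (V : ∀ p : S, TangentSpace (𝓡 m) (ι p)) (p : S) (i : Fin m) : ℝ :=
  let w : EuclideanSpace ℝ (Fin m) := mfderiv (𝓡 m) (𝓡 m) ψ (ι p) (V p)
  w i

/-- The functions `x^i` on the submanifold. -/
def coordFun (ι : S → M) (ψ : OpenPartialHomeomorph M (EuclideanSpace ℝ (Fin m))) (i : Fin m)
    (p : S) : ℝ :=
  ψ (ι p) i

/-- The component `∂ₐ x^i` of the tangent vector `eₐ = (∂ₐ x^i) ∂ᵢ`, where the coordinates on `S`
are those of the chart `φ`. -/
def frame (ι : S → M) (ψ : OpenPartialHomeomorph M (EuclideanSpace ℝ (Fin m)))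
    (φ : OpenPartialHomeomorph S (EuclideanSpace ℝ (Fin n))) (p : S) (a : Fin n) (i : Fin m) : ℝ :=
  pd φ a (coordFun ι ψ i) p

variable [IsManifold (𝓡 m) ∞ M]

/-- `V` is orthogonal to the submanifold. -/
def IsNormal (η : PseudoMetric (m := m) M) (ι : S → M)
    (V : ∀ p : S, TangentSpace (𝓡 m) (ι p)) : Prop :=
  ∀ (p : S) (v : TangentSpace (𝓡 n) p), η.form (ι p) (V p) (mfderiv (𝓡 n) (𝓡 m) ι p v) = 0

/-- The bilinear form `g` induced by `η` on the tangent spaces of `S` is nondegenerate, so that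
`(S, g)` is a pseudo-Riemannian submanifold. (In particular `ι` is an immersion.) -/
def InducedNondegenerate (η : PseudoMetric (m := m) M) (ι : S → M) : Prop :=
  ∀ (p : S) (v : TangentSpace (𝓡 n) p),
    (∀ w : TangentSpace (𝓡 n) p,
      η.form (ι p) (mfderiv (𝓡 n) (𝓡 m) ι p v) (mfderiv (𝓡 n) (𝓡 m) ι p w) = 0) → v = 0

variable (η : PseudoMetric (m := m) M) (ι : S → M)
  (ψ : OpenPartialHomeomorph M (EuclideanSpace ℝ (Fin m)))
  (φ : OpenPartialHomeomorph S (EuclideanSpace ℝ (Fin n)))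

/-- The components `g_{ab} = η(eₐ, e_b)` of the induced metric. -/
def inducedMat (p : S) : Matrix (Fin n) (Fin n) ℝ :=
  Matrix.of fun a b ↦ ip η ψ (ι p) (frame ι ψ φ p a) (frame ι ψ φ p b)

/-! ### The classical theory: formulas of Gauss and Weingarten

Vector fields along `ι` are represented by their component functions `S → Fin m → ℝ`. -/

/-- The coefficients `V^a = g^{ab} η(e_b, V)` of the tangential component `V^a eₐ` of `V`. -/
def tanCoeff (V : S → Fin m → ℝ) (p : S) (a : Fin n) : ℝ :=
  ∑ b, (inducedMat η ι ψ φ p)⁻¹ a b * ip η ψ (ι p) (frame ι ψ φ p b) (V p)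

/-- The tangential component. -/
def tanPart (V : S → Fin m → ℝ) (p : S) (i : Fin m) : ℝ :=
  ∑ a, tanCoeff η ι ψ φ V p a * frame ι ψ φ p a i

/-- The normal component. -/
def norPart (V : S → Fin m → ℝ) (p : S) (i : Fin m) : ℝ :=
  V p i - tanPart η ι ψ φ V p i

/-- `∇̄_X V` for `X` tangent to the submanifold and `V` a vector field of `M` along it. -/
def ambientDeriv (X V : S → Fin m → ℝ) (p : S) (i : Fin m) : ℝ :=
  ∑ a, tanCoeff η ι ψ φ X p a * pd φ a (fun p' ↦ V p' i) p
    + ∑ j, ∑ k, christoffel η ψ i j k (ι p) * X p j * V p k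

/-- `∇_X Y`, the tangential component of `∇̄_X Y` for `X`, `Y` tangent. -/
def leviCivita (X Y : S → Fin m → ℝ) : S → Fin m → ℝ :=
  tanPart η ι ψ φ (ambientDeriv η ι ψ φ X Y)

/-- The second fundamental form `α(X, Y)`, the normal component of `∇̄_X Y` for `X`, `Y` tangent. -/
def secondForm (X Y : S → Fin m → ℝ) : S → Fin m → ℝ :=
  norPart η ι ψ φ (ambientDeriv η ι ψ φ X Y)

/-- The normal connection `D_X ξ`, the normal component of `∇̄_X ξ` for `X` tangent and `ξ`
normal. -/
def normalDeriv (X ξ : S → Fin m → ℝ) : S → Fin m → ℝ :=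
  norPart η ι ψ φ (ambientDeriv η ι ψ φ X ξ)

/-- `(∇̃_X α)(Y, Z) = D_X (α(Y, Z)) - α(∇_X Y, Z) - α(Y, ∇_X Z)`. -/
def secondFormDeriv (X Y Z : S → Fin m → ℝ) (p : S) (i : Fin m) : ℝ :=
  normalDeriv η ι ψ φ X (secondForm η ι ψ φ Y Z) p i
    - secondForm η ι ψ φ (leviCivita η ι ψ φ X Y) Z p i
    - secondForm η ι ψ φ Y (leviCivita η ι ψ φ X Z) p i

/-! ### The bracket formulation -/

variable {r : ℕ} (br : MultilinearMap ℝ (fun _ : Fin (r + 1) ↦ C^∞⟮𝓡 n, S; ℝ⟯) C^∞⟮𝓡 n, S; ℝ⟯)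

/-- `(1 / √(r!)) {f, x^{i₁}, …, x^{i_r}}` for a multi-index `J = (i₁, …, i_r)`. -/
def bracketWith (f : S → ℝ) (J : Fin r → Fin m) (p : S) : ℝ :=
  (1 / √(r.factorial : ℝ)) *
    bracketAt br (Fin.cons f (fun k ↦ coordFun ι ψ (J k)) : Fin (r + 1) → S → ℝ) p

/-- `𝒫^{iJ} = (1 / √(r!)) {x^i, x^{i₁}, …, x^{i_r}}`. -/
def bracketP (i : Fin m) (J : Fin r → Fin m) (p : S) : ℝ :=
  bracketWith ι ψ br (coordFun ι ψ i) J p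

/-- `η_{IJ} = η_{i₁j₁} ⋯ η_{i_rj_r}`. -/
def metricMulti (I J : Fin r → Fin m) (q : M) : ℝ :=
  ∏ k, metricMat η ψ q (I k) (J k)

/-- The compatibility `𝒫^{iI} 𝒫^{jJ} η_{IJ} = ε γ² g^{ab} (∂ₐ x^i) (∂_b x^j)` of the bracket and
the metric, in all local coordinates on `M` and on `S`. -/
def IsCompatible (ε : ℝ) (γ : C^∞⟮𝓡 n, S; ℝ⟯) : Prop :=
  ∀ ψ ∈ IsManifold.maximalAtlas (𝓡 m) ∞ M, ∀ φ ∈ IsManifold.maximalAtlas (𝓡 n) ∞ S,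
    ∀ p ∈ φ.source, ι p ∈ ψ.source → ∀ i j : Fin m,
      ∑ I : Fin r → Fin m, ∑ J : Fin r → Fin m,
          bracketP ι ψ br i I p * bracketP ι ψ br j J p * metricMulti η ψ I J (ι p)
        = ε * γ p ^ 2 * ∑ a, ∑ b,
          (inducedMat η ι ψ φ p)⁻¹ a b * frame ι ψ φ p a i * frame ι ψ φ p b j

variable (ε : ℝ) (γ : C^∞⟮𝓡 n, S; ℝ⟯)

/-- `𝒟^{ij} = (ε / γ²) 𝒫^{iI} 𝒫^{jJ} η_{IJ}`. -/
def projD (i j : Fin m) (p : S) : ℝ :=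
  ε / γ p ^ 2 * ∑ I : Fin r → Fin m, ∑ J : Fin r → Fin m,
    bracketP ι ψ br i I p * bracketP ι ψ br j J p * metricMulti η ψ I J (ι p)

/-- `𝒟^i(f) = (ε / (γ² r!)) {x^i, x^I} {f, x^J} η_{IJ}`. -/
def derivD (i : Fin m) (f : S → ℝ) (p : S) : ℝ :=
  ε / γ p ^ 2 * ∑ I : Fin r → Fin m, ∑ J : Fin r → Fin m,
    bracketP ι ψ br i I p * bracketWith ι ψ br f J p * metricMulti η ψ I J (ι p)

/-- `∇̂^j V^i = 𝒟^j(V^i) + 𝒟^{jl} Γ̄^i_{lk} V^k`. -/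
def hatNabla (V : S → Fin m → ℝ) (j i : Fin m) (p : S) : ℝ :=
  derivD η ι ψ br ε γ j (fun p' ↦ V p' i) p
    + ∑ l, ∑ k, projD η ι ψ br ε γ j l p * christoffel η ψ i l k (ι p) * V p k

/-- `∇̂_X V = X_j ∇̂^j V^i ∂ᵢ`. -/
def hatDeriv (X V : S → Fin m → ℝ) (p : S) (i : Fin m) : ℝ :=
  ∑ j, lower η ψ (ι p) (X p) j * hatNabla η ι ψ br ε γ V j i p

/-- `∇̂^k T^{ij}` for a contravariant two-tensor `T` along `ι`. -/
def hatNabla₂ (T : Fin m → Fin m → S → ℝ) (k i j : Fin m) (p : S) : ℝ :=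
  derivD η ι ψ br ε γ k (T i j) p
    + ∑ l, ∑ s, projD η ι ψ br ε γ k l p *
      (christoffel η ψ i l s (ι p) * T s j p + christoffel η ψ j l s (ι p) * T i s p)

/-- `ℬ_N^{ij} = - ∇̂^i N^j`. -/
def tensorB (N : S → Fin m → ℝ) (i j : Fin m) (p : S) : ℝ :=
  - hatNabla η ι ψ br ε γ N i j p

/-- The map `ℬ_N(V) = ℬ_N^{ij} η_{jk} V^k ∂ᵢ`. -/
def mapB (N V : S → Fin m → ℝ) (p : S) (i : Fin m) : ℝ :=
  ∑ j, tensorB η ι ψ br ε γ N i j p * lower η ψ (ι p) (V p) j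

/-- `(∇̂_X ℬ_N)(V) = ∇̂_X (ℬ_N(V)) - ℬ_N(∇̂_X V)`. -/
def mapBDeriv (N X V : S → Fin m → ℝ) (p : S) (i : Fin m) : ℝ :=
  hatDeriv η ι ψ br ε γ X (mapB η ι ψ br ε γ N V) p i
    - mapB η ι ψ br ε γ N (hatDeriv η ι ψ br ε γ X V) p i

end Submanifold

end PseudoSub

end

/-! The three identities are local, so they are proved over the ring of smooth functions on the part
of a chart `φ` of the submanifold that `ι` maps into a chart `ψ` of `M`. There the geometry reduces
to algebra: commuting derivations `D a`, a metric connection `conn a` on ambient fields along the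
submanifold, and a coordinate frame `e a` with `conn a (e b) = conn b (e a)` and an invertible Gram
matrix.

The bracket enters only through `𝒟^i`. The Leibniz rule and Hadamard's lemma make `f ↦ 𝒟^i(f)` a
combination of the partial derivatives of `f`. For `f = x^j` it is `𝒟^{ij}`, which compatibility
identifies with `g^{ab} (∂ₐ x^i) (∂_b x^j)`. Since the frame vectors are independent, these values
fix the coefficients, and `𝒟^i(f) = g^{ab} (∂ₐ x^i) ∂_b f` (`derivD_eq`). Contraction with `X_i`
then turns `∇̂^i` into `∇̄_X` (`sum_low_raise`), and `ℬ_N` becomes the form `(Y, Z) ↦ -η(∇̄_Y N,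
Z)`.

Two facts about curvature suffice: `∇̄_X ∇̄_Y - ∇̄_Y ∇̄_X = R̄(X, Y) + ∇̄_{[X,Y]}` (`along_comm`)
and the skewness of `R̄(X, Y)` for the metric (`metric_riem`). In the covariant derivative of `ℬ_N`
the product rule leaves `-η(∇̄_X ∇̄_Y N, Z)` and a term along the tangential part of `∇̄_X Y`;
antisymmetrized in `X, Y` they give `-η(R̄(X, Y) N, Z) = η(R̄(X, Y) Z, N)` (`weingarten_deriv_sub`).
In the classical expression, pairing with `N` removes the outer normal projections, and the
tangential parts of `∇̄_X Z` and `∇̄_Y Z` cancel in the antisymmetrization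
(`metric_secondFormDeriv_sub`). -/

noncomputable section

namespace PseudoSub

/-! ### Codazzi equations over a ring with commuting derivations -/

/-- The algebraic data of a nondegenerate submanifold covered by one coordinate system: the ring
`A` of functions with its commuting partial derivatives `D a`, the module `V` of ambient vector
fields along the submanifold with its metric and pulled back Levi-Civita connection `conn a`, the
coordinate frame `e a` and the inverse `ginv` of its Gram matrix. -/
structure FrameConnection (A V : Type*) [CommRing A] [AddCommGroup V] [Module A V] (n : ℕ) where
  metric : V →ₗ[A] V →ₗ[A] A
  metric_symm : ∀ v w, metric v w = metric w v
  D : Fin n → A →+ A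
  D_mul : ∀ a f g, D a (f * g) = D a f * g + f * D a g
  D_comm : ∀ a b f, D a (D b f) = D b (D a f)
  conn : Fin n → V →+ V
  conn_smul : ∀ a f v, conn a (f • v) = D a f • v + f • conn a v
  compat : ∀ a v w, D a (metric v w) = metric (conn a v) w + metric v (conn a w)
  e : Fin n → V
  torsion : ∀ a b, conn a (e b) = conn b (e a)
  ginv : Matrix (Fin n) (Fin n) A
  ginv_mul : ginv * Matrix.of (fun a b ↦ metric (e a) (e b)) = 1

namespace FrameConnection

variable {A V : Type*} [CommRing A] [AddCommGroup V] [Module A V] {n : ℕ}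
  (F : FrameConnection A V n)

/-- The frame coefficients of the tangential component of a vector field. -/
def coef (v : V) (a : Fin n) : A := ∑ b, F.ginv a b * F.metric (F.e b) v

/-- The tangent field with given frame coefficients. -/
def vec (x : Fin n → A) : V := ∑ a, x a • F.e a

/-- The derivative of a function along a tangent field. -/
def derivAlong (x : Fin n → A) (f : A) : A := ∑ a, x a * F.D a f

/-- The ambient covariant derivative along a tangent field. -/
def along (x : Fin n → A) (v : V) : V := ∑ a, x a • F.conn a v

/-- The coefficients of the Lie bracket of two tangent fields. -/
def lie (x y : Fin n → A) (b : Fin n) : A := F.derivAlong x (y b) - F.derivAlong y (x b)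

/-- The ambient curvature operator, evaluated on two tangent fields. -/
def riem (x y : Fin n → A) (v : V) : V :=
  ∑ a, ∑ b, (x a * y b) • (F.conn a (F.conn b v) - F.conn b (F.conn a v))

/-- The left inverse `ginv` of the Gram matrix recovers the coefficients of a tangent field. In
particular a field `v` is tangent exactly when `F.vec (F.coef v) = v`, the form in which tangency is
assumed below. -/
theorem coef_vec (x : Fin n → A) : F.coef (F.vec x) = x := by
  have h : F.coef (F.vec x)
      = (F.ginv * Matrix.of (fun a b ↦ F.metric (F.e a) (F.e b))).mulVec x := by
    rw [← Matrix.mulVec_mulVec]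
    funext a
    simp [coef, vec, Matrix.mulVec, dotProduct, mul_comm]
  rw [h, F.ginv_mul, Matrix.one_mulVec]

theorem coef_sub (v w : V) : F.coef (v - w) = F.coef v - F.coef w := by
  funext a
  simp [coef, mul_sub]

theorem along_sub (x : Fin n → A) (v w : V) : F.along x (v - w) = F.along x v - F.along x w := by
  simp [along, smul_sub]

theorem along_sum {κ : Type*} (s : Finset κ) (x : Fin n → A) (v : κ → V) :
    F.along x (∑ k ∈ s, v k) = ∑ k ∈ s, F.along x (v k) := by
  simp only [along, map_sum, Finset.smul_sum]
  exact Finset.sum_comm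

theorem along_coeff_sub (x y : Fin n → A) (v : V) :
    F.along (x - y) v = F.along x v - F.along y v := by
  simp [along, sub_smul]

theorem along_smul (x : Fin n → A) (f : A) (v : V) :
    F.along x (f • v) = F.derivAlong x f • v + f • F.along x v := by
  simp only [along, derivAlong, F.conn_smul, smul_add, Finset.sum_add_distrib, Finset.sum_smul,
    Finset.smul_sum, smul_smul, mul_comm]

theorem derivAlong_metric (x : Fin n → A) (v w : V) :
    F.derivAlong x (F.metric v w) = F.metric (F.along x v) w + F.metric v (F.along x w) := by
  simp [derivAlong, along, F.compat, mul_add, Finset.sum_add_distrib]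

/-- Vanishing torsion for arbitrary tangent fields: the terms containing `conn a (e b)` are
symmetric and cancel, and only derivatives of the coefficients survive. -/
theorem along_vec_sub (x y : Fin n → A) :
    F.along x (F.vec y) - F.along y (F.vec x) = F.vec (F.lie x y) := by
  have h : ∀ x y : Fin n → A, F.along x (F.vec y)
      = (∑ b, F.derivAlong x (y b) • F.e b) + ∑ b, ∑ a, (y b * x a) • F.conn a (F.e b) := by
    intro x y
    rw [vec, F.along_sum, ← Finset.sum_add_distrib]
    refine Finset.sum_congr rfl fun b _ ↦ ?_
    rw [F.along_smul, along, Finset.smul_sum]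
    simp only [smul_smul]
  have hs : ∑ b, ∑ a, (x b * y a) • F.conn a (F.e b)
      = ∑ b, ∑ a, (y b * x a) • F.conn a (F.e b) := by
    rw [Finset.sum_comm]
    refine Finset.sum_congr rfl fun b _ ↦ Finset.sum_congr rfl fun a _ ↦ ?_
    rw [F.torsion, mul_comm]
  rw [h, h, hs, add_sub_add_right_eq_sub, ← Finset.sum_sub_distrib]
  simp [vec, lie, sub_smul]

theorem coef_along_vec_sub (x y : Fin n → A) :
    F.coef (F.along x (F.vec y)) - F.coef (F.along y (F.vec x)) = F.lie x y := by
  rw [← F.coef_sub, F.along_vec_sub, F.coef_vec]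

/-- The second derivatives of `v` assemble into the curvature, which needs no bracket term of its
own because coordinate fields commute. The derivatives of the coefficients of `x` and `y` give the
Lie bracket. -/
theorem along_comm (x y : Fin n → A) (v : V) :
    F.along x (F.along y v) - F.along y (F.along x v)
      = F.riem x y v + F.along (F.lie x y) v := by
  have h : ∀ x y : Fin n → A, F.along x (F.along y v)
      = (∑ b, F.derivAlong x (y b) • F.conn b v)
        + ∑ b, ∑ a, (y b * x a) • F.conn a (F.conn b v) := by
    intro x y
    conv_lhs => rw [along.eq_def F y, F.along_sum]
    rw [← Finset.sum_add_distrib]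
    refine Finset.sum_congr rfl fun b _ ↦ ?_
    rw [F.along_smul, along, Finset.smul_sum]
    simp only [smul_smul]
  have h1 : F.riem x y v = (∑ b, ∑ a, (y b * x a) • F.conn a (F.conn b v))
      - ∑ b, ∑ a, (x b * y a) • F.conn a (F.conn b v) := by
    simp only [riem, smul_sub, Finset.sum_sub_distrib]
    congr 1
    rw [Finset.sum_comm]
    simp only [mul_comm]
  have h2 : F.along (F.lie x y) v = (∑ b, F.derivAlong x (y b) • F.conn b v)
      - ∑ b, F.derivAlong y (x b) • F.conn b v := by
    simp [along, lie, sub_smul]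
  rw [h, h, h1, h2]
  abel

/-- Apply the commuting derivations to `metric v w`: the mixed terms, with one derivative on each
factor, cancel. -/
theorem metric_conn_comm (a b : Fin n) (v w : V) :
    F.metric (F.conn a (F.conn b v) - F.conn b (F.conn a v)) w
      = - F.metric v (F.conn a (F.conn b w) - F.conn b (F.conn a w)) := by
  have h := F.D_comm a b (F.metric v w)
  simp only [F.compat, map_add] at h
  simp only [map_sub, LinearMap.sub_apply]
  linear_combination h

theorem metric_riem (x y : Fin n → A) (v w : V) :
    F.metric (F.riem x y v) w = - F.metric v (F.riem x y w) := by
  simp only [riem, map_sum, LinearMap.sum_apply, map_smul, LinearMap.smul_apply,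
    F.metric_conn_comm _ _ v w, smul_neg, Finset.sum_neg_distrib]

variable {N : V}

theorem metric_vec_normal (hN : ∀ a, F.metric (F.e a) N = 0) (x : Fin n → A) :
    F.metric (F.vec x) N = 0 := by
  simp [vec, hN]

/-- The normal component of a vector field. -/
def nor (v : V) : V := v - F.vec (F.coef v)

/-- The covariant derivative of the second fundamental form with respect to the connection of
van der Waerden and Bortolotti. -/
def secondFormDeriv (x y : Fin n → A) (z : V) : V :=
  F.nor (F.along x (F.nor (F.along y z))) - F.nor (F.along (F.coef (F.along x (F.vec y))) z)
    - F.nor (F.along y (F.vec (F.coef (F.along x z))))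

/-- The Codazzi equation in its classical form. -/
theorem metric_secondFormDeriv_sub (hN : ∀ a, F.metric (F.e a) N = 0) (x y : Fin n → A) (z : V) :
    F.metric (F.secondFormDeriv x y z - F.secondFormDeriv y x z) N
      = F.metric (F.riem x y z) N := by
  -- Pairing with `N` does not see tangential parts, so each outer projection `nor` can be dropped.
  have h1 : ∀ v, F.metric (F.nor v) N = F.metric v N := by
    intro v
    simp [nor, F.metric_vec_normal hN]
  have h2 := congrArg (fun v ↦ F.metric v N) (F.along_comm x y z)
  have h3 := congrArg (fun c ↦ F.metric (F.along c z) N) (F.coef_along_vec_sub x y)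
  simp only [F.along_coeff_sub, map_sub, map_add, LinearMap.sub_apply, LinearMap.add_apply]
    at h2 h3
  simp only [secondFormDeriv, map_sub, LinearMap.sub_apply, h1]
  simp only [nor.eq_1, F.along_sub, map_sub, LinearMap.sub_apply]
  -- The tangential part removed from `∇̄_y z` reappears in the last term of `secondFormDeriv y x
  -- z`, and likewise with `x` and `y` exchanged, so only the commutator and the bracket term
  -- remain.
  linear_combination h2 - h3

/-- The tensor `ℬ_N`, as a bilinear form in two ambient vector fields. -/
def weingarten (N v w : V) : A := - ∑ b, F.coef v b * F.metric (F.conn b N) w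

theorem weingarten_eq (N v w : V) :
    F.weingarten N v w = - F.metric (F.along (F.coef v) N) w := by
  simp [weingarten, along]

/-- The Codazzi equation in terms of the covariant derivative of `ℬ_N`. -/
theorem weingarten_deriv_sub (x y : Fin n → A) (z N : V) :
    (F.derivAlong x (F.weingarten N (F.vec y) z) - F.weingarten N (F.along x (F.vec y)) z
        - F.weingarten N (F.vec y) (F.along x z))
      - (F.derivAlong y (F.weingarten N (F.vec x) z) - F.weingarten N (F.along y (F.vec x)) z
        - F.weingarten N (F.vec x) (F.along y z))
      = F.metric (F.riem x y z) N := by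
  have h2 := congrArg (fun v ↦ F.metric v z) (F.along_comm x y N)
  have h3 := congrArg (fun c ↦ F.metric (F.along c N) z) (F.coef_along_vec_sub x y)
  have h4 := F.metric_riem x y z N
  have h5 := F.metric_symm (F.riem x y N) z
  have hneg : ∀ x f, F.derivAlong x (-f) = - F.derivAlong x f := by
    intro x f
    simp [derivAlong]
  simp only [F.along_coeff_sub, map_sub, map_add, LinearMap.sub_apply, LinearMap.add_apply]
    at h2 h3
  -- Metric compatibility produces `-⟨∇̄_y N, ∇̄_x z⟩`, which cancels against the term with `∇̄_x z`
  -- in the second slot. The remainder is minus the curvature acting on `N`, moved to `z` by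
  -- skewness.
  simp only [F.weingarten_eq, hneg, F.derivAlong_metric, F.coef_vec]
  linear_combination -h2 + h3 - h4 - h5

end FrameConnection

/-! ### The same structure in components, and the curvature tensor -/

/-- The data of a `FrameConnection` in components: the metric coefficients `G`, the Christoffel
symbols `Γ` and the components `e a i` of the coordinate frame. -/
structure CoordFrame (A : Type*) [CommRing A] (m n : ℕ) where
  D : Fin n → A →+ A
  D_mul : ∀ a f g, D a (f * g) = D a f * g + f * D a g
  D_comm : ∀ a b f, D a (D b f) = D b (D a f)
  G : Matrix (Fin m) (Fin m) A
  G_symm : ∀ i j, G i j = G j i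
  Γ : Fin m → Fin m → Fin m → A
  Γ_symm : ∀ i j k, Γ i j k = Γ i k j
  e : Fin n → Fin m → A
  D_e : ∀ a b i, D a (e b i) = D b (e a i)
  D_G : ∀ a i j, D a (G i j) = ∑ k, e a k * ∑ l, (G l j * Γ l k i + G i l * Γ l k j)
  ginv : Matrix (Fin n) (Fin n) A
  ginv_mul : ginv * Matrix.of (fun a b ↦ ∑ i, ∑ j, G i j * e a i * e b j) = 1

namespace CoordFrame

variable {A : Type*} [CommRing A] {m n : ℕ} (C : CoordFrame A m n)

/-- The connection form in the coordinate frame. -/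
def θ (a : Fin n) (i k : Fin m) : A := ∑ j, C.Γ i j k * C.e a j

/-- The ambient inner product of vector fields given by their components. -/
def metric : (Fin m → A) →ₗ[A] (Fin m → A) →ₗ[A] A :=
  LinearMap.mk₂ A (fun v w ↦ ∑ i, ∑ j, C.G i j * v i * w j)
    (fun v v' w ↦ by simp [mul_add, add_mul, Finset.sum_add_distrib])
    (fun c v w ↦ by simp only [Pi.smul_apply, smul_eq_mul, Finset.mul_sum]; congr! 2; ring)
    (fun v w w' ↦ by simp [mul_add, Finset.sum_add_distrib])
    (fun c v w ↦ by simp only [Pi.smul_apply, smul_eq_mul, Finset.mul_sum]; congr! 2; ring)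

theorem metric_apply (v w : Fin m → A) : C.metric v w = ∑ i, ∑ j, C.G i j * v i * w j := rfl

/-- Lowering an index. -/
def low (v : Fin m → A) (i : Fin m) : A := ∑ j, C.G i j * v j

theorem metric_eq_low (v w : Fin m → A) : C.metric v w = ∑ i, v i * C.low w i := by
  simp only [metric_apply, low, Finset.mul_sum]
  congr! 2
  ring

theorem metric_symm (v w : Fin m → A) : C.metric v w = C.metric w v := by
  rw [metric_apply, metric_apply, Finset.sum_comm]
  refine Finset.sum_congr rfl fun i _ ↦ Finset.sum_congr rfl fun j _ ↦ ?_
  rw [C.G_symm]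
  ring

/-- The covariant derivative along a vector of the coordinate frame. -/
def conn (a : Fin n) : (Fin m → A) →+ (Fin m → A) where
  toFun v i := C.D a (v i) + ∑ k, C.θ a i k * v k
  map_zero' := by
    funext i
    simp
  map_add' v w := by
    funext i
    simp only [Pi.add_apply, map_add, mul_add, Finset.sum_add_distrib]
    abel

theorem conn_apply (a : Fin n) (v : Fin m → A) (i : Fin m) :
    C.conn a v i = C.D a (v i) + ∑ k, C.θ a i k * v k := rfl

theorem D_G_eq (a : Fin n) (i j : Fin m) :
    C.D a (C.G i j) = ∑ l, (C.G l j * C.θ a l i + C.G i l * C.θ a l j) := by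
  rw [C.D_G]
  simp only [θ, Finset.mul_sum, ← Finset.sum_add_distrib]
  rw [Finset.sum_comm]
  congr! 2
  ring

/-- Compatibility of the metric with the Christoffel symbols says that lowering an index commutes
with covariant differentiation; the `θ` term is the correction for a covariant index. -/
theorem D_low (a : Fin n) (v : Fin m → A) (i : Fin m) :
    C.D a (C.low v i) = C.low (C.conn a v) i + ∑ s, C.low v s * C.θ a s i := by
  simp only [low, map_sum, C.D_mul, conn_apply, mul_add, Finset.sum_add_distrib, C.D_G_eq,
    Finset.sum_mul, add_mul, Finset.mul_sum]
  rw [Finset.sum_comm (f := fun j l ↦ C.G l j * C.θ a l i * v j),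
    Finset.sum_comm (f := fun j l ↦ C.G i l * C.θ a l j * v j)]
  have h1 : ∀ l j, C.G l j * C.θ a l i * v j = C.G l j * v j * C.θ a l i := by
    intros
    ring
  simp only [h1, mul_assoc (C.G i _)]
  ring

theorem D_metric (a : Fin n) (v w : Fin m → A) :
    C.D a (C.metric v w) = C.metric (C.conn a v) w + C.metric v (C.conn a w) := by
  simp only [metric_eq_low, map_sum, C.D_mul, C.D_low, conn_apply, mul_add, add_mul,
    Finset.sum_add_distrib, Finset.mul_sum, Finset.sum_mul]
  rw [Finset.sum_comm (f := fun i s ↦ C.θ a i s * v s * C.low w i)]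
  have h1 : ∀ i s, C.θ a i s * v s * C.low w i = v s * (C.low w i * C.θ a i s) := by
    intros
    ring
  simp only [h1]
  ring

theorem conn_e (a b : Fin n) : C.conn a (C.e b) = C.conn b (C.e a) := by
  funext i
  rw [conn_apply, conn_apply, C.D_e]
  congr 1
  simp only [θ, Finset.sum_mul]
  rw [Finset.sum_comm]
  refine Finset.sum_congr rfl fun j _ ↦ Finset.sum_congr rfl fun k _ ↦ ?_
  rw [C.Γ_symm]
  ring

/-- The `FrameConnection` with the given components. -/
@[simps]
def toFrameConnection : FrameConnection A (Fin m → A) n where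
  metric := C.metric
  metric_symm := C.metric_symm
  D := C.D
  D_mul := C.D_mul
  D_comm := C.D_comm
  conn := C.conn
  conn_smul a f v := by
    funext i
    simp only [conn_apply, Pi.smul_apply, Pi.add_apply, smul_eq_mul, C.D_mul, mul_add,
      Finset.mul_sum, add_assoc]
    congr! 3
    ring
  compat := C.D_metric
  e := C.e
  torsion := C.conn_e
  ginv := C.ginv
  ginv_mul := C.ginv_mul

/-- The structure equation `dθ + θ ∧ θ`: the terms with derivatives of `v` are symmetric in `a, b`
and drop out. -/
theorem conn_conn_sub (a b : Fin n) (v : Fin m → A) (i : Fin m) :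
    C.conn a (C.conn b v) i - C.conn b (C.conn a v) i
      = ∑ k, (C.D a (C.θ b i k) - C.D b (C.θ a i k)
        + ∑ p, (C.θ a i p * C.θ b p k - C.θ b i p * C.θ a p k)) * v k := by
  have h : ∀ a b, C.conn a (C.conn b v) i = C.D a (C.D b (v i))
      + (∑ k, C.D a (C.θ b i k) * v k) + (∑ k, C.θ b i k * C.D a (v k))
      + (∑ k, C.θ a i k * C.D b (v k)) + ∑ k, (∑ p, C.θ a i p * C.θ b p k) * v k := by
    intro a b
    simp only [conn_apply, map_add, map_sum, C.D_mul, mul_add, Finset.sum_add_distrib,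
      Finset.mul_sum, Finset.sum_mul]
    rw [Finset.sum_comm (f := fun k p ↦ C.θ a i p * C.θ b p k * v k)]
    simp only [mul_assoc, add_assoc]
  rw [h, h, C.D_comm a b]
  simp only [add_mul, sub_mul, Finset.sum_add_distrib, Finset.sum_sub_distrib]
  ring

/-- The components of the curvature, with `dΓ j i l k` the derivative of `Γ^i_{lk}` in the
direction `j`. -/
def R (dΓ : Fin m → Fin m → Fin m → Fin m → A) (i k j l : Fin m) : A :=
  dΓ j i l k - dΓ l i j k + ∑ p, (C.Γ i j p * C.Γ p l k - C.Γ i l p * C.Γ p j k)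

/-- The hypothesis `hdΓ` is the chain rule for functions pulled back from `M`. Differentiating `θ`
also produces second derivatives of the immersion, which are symmetric by `D_e` and cancel, so the
pulled back ambient curvature remains. -/
theorem conn_conn_sub_eq_curvature {dΓ : Fin m → Fin m → Fin m → Fin m → A}
    (hdΓ : ∀ a i j k, C.D a (C.Γ i j k) = ∑ l, C.e a l * dΓ l i j k)
    (a b : Fin n) (v : Fin m → A) (i : Fin m) :
    C.conn a (C.conn b v) i - C.conn b (C.conn a v) i
      = ∑ k, ∑ j, ∑ l, C.R dΓ i k j l * C.e a j * C.e b l * v k := by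
  rw [conn_conn_sub]
  refine Finset.sum_congr rfl fun k _ ↦ ?_
  simp only [← Finset.sum_mul]
  congr 1
  have h1 : C.D a (C.θ b i k) - C.D b (C.θ a i k)
      = ∑ j, ∑ l, (dΓ j i l k - dΓ l i j k) * C.e a j * C.e b l := by
    simp only [θ, map_sum, C.D_mul, hdΓ, Finset.sum_add_distrib, Finset.sum_mul, sub_mul,
      Finset.sum_sub_distrib, C.D_e b a]
    rw [Finset.sum_comm]
    have e1 : ∀ j l, C.e a j * dΓ j i l k * C.e b l = dΓ j i l k * C.e a j * C.e b l := by
      intros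
      ring
    have e2 : ∀ j l, C.e b l * dΓ l i j k * C.e a j = dΓ l i j k * C.e a j * C.e b l := by
      intros
      ring
    simp only [e1, e2]
    ring
  have h2 : ∀ a b, ∑ p, C.θ a i p * C.θ b p k
      = ∑ j, ∑ l, (∑ p, C.Γ i j p * C.Γ p l k) * C.e a j * C.e b l := by
    intro a b
    simp only [θ, Finset.sum_mul]
    rw [Finset.sum_comm]
    refine Finset.sum_congr rfl fun j _ ↦ ?_
    rw [Finset.sum_comm]
    refine Finset.sum_congr rfl fun p _ ↦ ?_
    rw [Finset.mul_sum]
    congr! 1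
    ring
  have h3 : ∑ p, C.θ b i p * C.θ a p k
      = ∑ j, ∑ l, (∑ p, C.Γ i l p * C.Γ p j k) * C.e a j * C.e b l := by
    rw [h2, Finset.sum_comm]
    congr! 2
    ring
  rw [h1, Finset.sum_sub_distrib, h2, h3]
  simp only [R, ← Finset.sum_sub_distrib, ← Finset.sum_add_distrib]
  refine Finset.sum_congr rfl fun j _ ↦ Finset.sum_congr rfl fun l _ ↦ ?_
  rw [Finset.sum_sub_distrib]
  ring

theorem riem_eq {dΓ : Fin m → Fin m → Fin m → Fin m → A}
    (hdΓ : ∀ a i j k, C.D a (C.Γ i j k) = ∑ l, C.e a l * dΓ l i j k)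
    (x y : Fin n → A) (v : Fin m → A) (i : Fin m) :
    C.toFrameConnection.riem x y v i
      = ∑ k, ∑ j, ∑ l, C.R dΓ i k j l * C.toFrameConnection.vec x j
          * C.toFrameConnection.vec y l * v k := by
  simp only [FrameConnection.riem, Finset.sum_apply, Pi.smul_apply, Pi.sub_apply, smul_eq_mul,
    toFrameConnection_conn, C.conn_conn_sub_eq_curvature hdΓ, FrameConnection.vec,
    toFrameConnection_e]
  simp only [Finset.sum_mul, Finset.mul_sum]
  have h : ∀ f : Fin n → Fin n → Fin m → Fin m → Fin m → A,
      ∑ a, ∑ b, ∑ k, ∑ j, ∑ l, f a b k j l = ∑ k, ∑ j, ∑ l, ∑ b, ∑ a, f a b k j l := by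
    intro f
    have e : ∀ k j l, ∑ b, ∑ a, f a b k j l = ∑ q : Fin n × Fin n, f q.1 q.2 k j l := by
      intro k j l
      rw [Finset.sum_comm, Fintype.sum_prod_type]
    simp only [e]
    rw [← Fintype.sum_prod_type' (f := fun a b ↦ ∑ k, ∑ j, ∑ l, f a b k j l), Finset.sum_comm]
    refine Finset.sum_congr rfl fun k _ ↦ ?_
    rw [Finset.sum_comm]
    exact Finset.sum_congr rfl fun j _ ↦ Finset.sum_comm
  rw [h]
  congr! 5
  ring

/-- The covariant derivative of a contravariant two-tensor along a vector of the frame. -/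
def conn₂ (a : Fin n) (T : Fin m → Fin m → A) (i j : Fin m) : A :=
  C.D a (T i j) + ∑ l, ∑ s, C.e a l * (C.Γ i l s * T s j + C.Γ j l s * T i s)

/-- A contravariant two-tensor as a bilinear form. -/
def pair (T : Fin m → Fin m → A) (v w : Fin m → A) : A :=
  ∑ i, ∑ j, T i j * C.low v i * C.low w j

theorem conn₂_eq (a : Fin n) (T : Fin m → Fin m → A) (i j : Fin m) :
    C.conn₂ a T i j = C.D a (T i j) + ∑ s, (C.θ a i s * T s j + C.θ a j s * T i s) := by
  rw [conn₂, Finset.sum_comm]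
  simp only [θ, Finset.sum_mul, ← Finset.sum_add_distrib]
  congr! 3
  ring

/-- The Leibniz rule for the contraction of `T` with two fields. The connection terms of `conn₂` are
exactly those absorbed by `D_low`. -/
theorem sum_conn₂ (a : Fin n) (T : Fin m → Fin m → A) (v w : Fin m → A) :
    ∑ i, ∑ j, C.low v i * C.low w j * C.conn₂ a T i j
      = C.D a (C.pair T v w) - C.pair T (C.conn a v) w - C.pair T v (C.conn a w) := by
  have e1 : ∑ i, ∑ j, C.low v i * C.low w j * ∑ s, C.θ a i s * T s j
      = ∑ i, ∑ j, T i j * (∑ s, C.low v s * C.θ a s i) * C.low w j := by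
    simp only [Finset.mul_sum, Finset.sum_mul]
    rw [Finset.sum_comm, Finset.sum_comm (f := fun i j ↦ ∑ s, T i j * _ * C.low w j)]
    refine Finset.sum_congr rfl fun j _ ↦ ?_
    rw [Finset.sum_comm]
    congr! 2
    ring
  have e2 : ∑ i, ∑ j, C.low v i * C.low w j * ∑ s, C.θ a j s * T i s
      = ∑ i, ∑ j, T i j * C.low v i * ∑ s, C.low w s * C.θ a s j := by
    simp only [Finset.mul_sum]
    refine Finset.sum_congr rfl fun i _ ↦ ?_
    rw [Finset.sum_comm]
    congr! 2
    ring
  have e3 : ∑ i, ∑ j, C.low v i * C.low w j * C.D a (T i j)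
      = ∑ i, ∑ j, C.D a (T i j) * C.low v i * C.low w j := by
    congr! 2
    ring
  simp only [conn₂_eq, Finset.sum_add_distrib, mul_add]
  rw [e1, e2, e3]
  simp only [pair, map_sum, C.D_mul, C.D_low, mul_add, add_mul, Finset.sum_add_distrib]
  ring

end CoordFrame

/-! ### Parameter integrals and Hadamard's lemma -/

open MeasureTheory in
theorem hasFDerivAt_intervalIntegral_of_contDiff {E F : Type*} [NormedAddCommGroup E]
    [NormedSpace ℝ E] [FiniteDimensional ℝ E] [NormedAddCommGroup F] [NormedSpace ℝ F]
    {f : E × ℝ → F} (hf : ContDiff ℝ 1 f) (x : E) :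
    HasFDerivAt (fun x ↦ ∫ t in (0 : ℝ)..1, f (x, t))
      (∫ t in (0 : ℝ)..1, (fderiv ℝ f (x, t)).comp (ContinuousLinearMap.inl ℝ E ℝ)) x := by
  have hc : Continuous fun q : E × ℝ ↦ (fderiv ℝ f q).comp (ContinuousLinearMap.inl ℝ E ℝ) :=
    (hf.continuous_fderiv one_ne_zero).clm_comp continuous_const
  -- A bound for the derivative on the compact set (closed unit ball around `x`) × `[0, 1]` serves
  -- as the dominating constant.
  obtain ⟨C, hC⟩ := ((isCompact_closedBall x 1).prod (isCompact_Icc (a := (0 : ℝ)) (b := 1)))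
    |>.exists_bound_of_continuousOn hc.continuousOn
  refine intervalIntegral.hasFDerivAt_integral_of_dominated_of_fderiv_le
    (F' := fun x t ↦ (fderiv ℝ f (x, t)).comp (ContinuousLinearMap.inl ℝ E ℝ))
    (bound := fun _ ↦ C) (Metric.closedBall_mem_nhds x one_pos) ?_ ?_ ?_ ?_ ?_ ?_
  · exact Filter.Eventually.of_forall fun y ↦ (hf.continuous.comp
      (by fun_prop : Continuous fun t : ℝ ↦ (y, t))).aestronglyMeasurable
  · exact (hf.continuous.comp (by fun_prop : Continuous fun t : ℝ ↦ (x, t))).intervalIntegrable _ _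
  · exact (hc.comp (by fun_prop : Continuous fun t : ℝ ↦ (x, t))).aestronglyMeasurable
  · refine Filter.Eventually.of_forall fun t ht y hy ↦ hC (y, t) ⟨hy, ?_⟩
    rw [Set.uIoc_of_le zero_le_one] at ht
    exact ⟨ht.1.le, ht.2⟩
  · exact intervalIntegrable_const
  · refine Filter.Eventually.of_forall fun t _ y _ ↦ ?_
    have h1 : HasFDerivAt f (fderiv ℝ f (y, t)) (y, t) :=
      (hf.differentiable one_ne_zero _).hasFDerivAt
    exact h1.comp y (hasFDerivAt_prodMk_left y t)

/-- Smooth dependence of an integral on a parameter. -/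
theorem contDiff_intervalIntegral {E : Type} [NormedAddCommGroup E] [NormedSpace ℝ E]
    [FiniteDimensional ℝ E] (k : ℕ) : ∀ {F : Type} [NormedAddCommGroup F] [NormedSpace ℝ F]
    {f : E × ℝ → F}, ContDiff ℝ ∞ f → ContDiff ℝ k fun x ↦ ∫ t in (0 : ℝ)..1, f (x, t) := by
  -- The target `F` stays universally quantified, since the induction step passes to a derivative
  -- with values in `E →L[ℝ] F`.
  induction k with
  | zero =>
    intro F _ _ f hf
    refine contDiff_zero.2 (Differentiable.continuous (𝕜 := ℝ) fun x ↦ ?_)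
    exact (hasFDerivAt_intervalIntegral_of_contDiff (hf.of_le (by simp)) x).differentiableAt
  | succ k ih =>
    intro F _ _ f hf
    have hd := hasFDerivAt_intervalIntegral_of_contDiff (hf.of_le (by simp))
    push_cast
    refine contDiff_succ_iff_hasFDerivAt.2 ⟨_, ih (f := fun q : E × ℝ ↦
      (fderiv ℝ f q).comp (ContinuousLinearMap.inl ℝ E ℝ)) ?_, hd⟩
    exact (hf.fderiv_right (by simp)).clm_comp contDiff_const

/-- Hadamard's lemma. -/
theorem exists_hadamard {E : Type} [NormedAddCommGroup E] [NormedSpace ℝ E]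
    [FiniteDimensional ℝ E] {f : E → ℝ} (hf : ContDiff ℝ ∞ f) (x : E) :
    ∃ h : E → E →L[ℝ] ℝ, ContDiff ℝ ∞ h ∧ h x = fderiv ℝ f x ∧
      ∀ y, f y = f x + h y (y - x) := by
  have hg : ContDiff ℝ ∞ fun q : E × ℝ ↦ fderiv ℝ f (x + q.2 • (q.1 - x)) :=
    (hf.fderiv_right (by simp)).comp (by fun_prop)
  -- The witness averages `fderiv ℝ f` over the segment from `x` to `y`; the identity is the
  -- fundamental theorem of calculus along that segment.
  refine ⟨fun y ↦ ∫ t in (0 : ℝ)..1, fderiv ℝ f (x + t • (y - x)),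
    contDiff_infty.2 fun k ↦ contDiff_intervalIntegral k hg, by simp, fun y ↦ ?_⟩
  have hcont : Continuous fun t : ℝ ↦ fderiv ℝ f (x + t • (y - x)) :=
    hg.continuous.comp (by fun_prop : Continuous fun t : ℝ ↦ (y, t))
  have h1 : ∀ t ∈ Set.uIcc (0 : ℝ) 1, HasDerivAt (fun t : ℝ ↦ f (x + t • (y - x)))
      (fderiv ℝ f (x + t • (y - x)) (y - x)) t := by
    intro t _
    have h2 : HasDerivAt (fun t : ℝ ↦ x + t • (y - x)) (y - x) t := by
      simpa using ((hasDerivAt_id t).smul_const (y - x)).const_add x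
    exact ((hf.differentiable (by simp) _).hasFDerivAt).comp_hasDerivAt t h2
  have h3 := intervalIntegral.integral_eq_sub_of_hasDerivAt h1
    ((hcont.clm_apply continuous_const).intervalIntegrable _ _)
  rw [ContinuousLinearMap.intervalIntegral_apply (hcont.intervalIntegrable _ _), h3]
  simp

/-! ### Calculus of coordinate partial derivatives -/

section PartialDerivative

variable {k : ℕ} {S : Type*} [TopologicalSpace S]
  {φ : OpenPartialHomeomorph S (EuclideanSpace ℝ (Fin k))} {W : Set S} {f g : S → ℝ} {q : S}

theorem isOpen_target_inter_preimage (hW : IsOpen W) : IsOpen (φ.target ∩ φ.symm ⁻¹' W) :=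
  φ.symm.isOpen_inter_preimage hW

theorem mem_target_inter_preimage (hWφ : W ⊆ φ.source) (hq : q ∈ W) :
    φ q ∈ φ.target ∩ φ.symm ⁻¹' W :=
  ⟨φ.map_source (hWφ hq), by simpa [φ.left_inv (hWφ hq)] using hq⟩

theorem pd_congr_nhds (hq : q ∈ φ.source) (h : f =ᶠ[𝓝 q] g) (a : Fin k) :
    pd φ a f q = pd φ a g q := by
  have h1 : Filter.Tendsto φ.symm (𝓝 (φ q)) (𝓝 q) := by
    have := φ.symm.continuousAt (φ.map_source hq)
    rwa [ContinuousAt, φ.left_inv hq] at this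
  have h2 : (fun y ↦ f (φ.symm y)) =ᶠ[𝓝 (φ q)] fun y ↦ g (φ.symm y) :=
    h.comp_tendsto h1
  rw [pd, pd, h2.fderiv_eq]

theorem pd_congr (hW : IsOpen W) (hWφ : W ⊆ φ.source) (hq : q ∈ W) (h : Set.EqOn f g W)
    (a : Fin k) : pd φ a f q = pd φ a g q :=
  pd_congr_nhds (hWφ hq) (h.eventuallyEq_of_mem (hW.mem_nhds hq)) a

variable [ChartedSpace (EuclideanSpace ℝ (Fin k)) S]

theorem contDiffOn_comp_symm
    (hφ : φ ∈ IsManifold.maximalAtlas (𝓡 k) ∞ S) (hf : ContMDiffOn (𝓡 k) 𝓘(ℝ, ℝ) ∞ f W) :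
    ContDiffOn ℝ ∞ (fun y ↦ f (φ.symm y)) (φ.target ∩ φ.symm ⁻¹' W) := by
  rw [← contMDiffOn_iff_contDiffOn]
  exact hf.comp ((contMDiffOn_symm_of_mem_maximalAtlas hφ).mono Set.inter_subset_left)
    fun y hy ↦ hy.2

theorem contDiffAt_comp_symm
    (hφ : φ ∈ IsManifold.maximalAtlas (𝓡 k) ∞ S) (hW : IsOpen W) (hWφ : W ⊆ φ.source)
    (hf : ContMDiffOn (𝓡 k) 𝓘(ℝ, ℝ) ∞ f W) (hq : q ∈ W) :
    ContDiffAt ℝ ∞ (fun y ↦ f (φ.symm y)) (φ q) :=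
  (contDiffOn_comp_symm hφ hf).contDiffAt
    ((isOpen_target_inter_preimage hW).mem_nhds (mem_target_inter_preimage hWφ hq))

theorem differentiableAt_comp_symm
    (hφ : φ ∈ IsManifold.maximalAtlas (𝓡 k) ∞ S) (hW : IsOpen W) (hWφ : W ⊆ φ.source)
    (hf : ContMDiffOn (𝓡 k) 𝓘(ℝ, ℝ) ∞ f W) (hq : q ∈ W) :
    DifferentiableAt ℝ (fun y ↦ f (φ.symm y)) (φ q) :=
  (contDiffAt_comp_symm hφ hW hWφ hf hq).differentiableAt (by simp)

theorem contMDiffOn_pd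
    (hφ : φ ∈ IsManifold.maximalAtlas (𝓡 k) ∞ S) (hW : IsOpen W) (hWφ : W ⊆ φ.source)
    (hf : ContMDiffOn (𝓡 k) 𝓘(ℝ, ℝ) ∞ f W) (a : Fin k) :
    ContMDiffOn (𝓡 k) 𝓘(ℝ, ℝ) ∞ (pd φ a f) W := by
  have h1 : ContDiffOn ℝ ∞
      (fun y ↦ fderiv ℝ (fun y ↦ f (φ.symm y)) y (EuclideanSpace.single a 1))
      (φ.target ∩ φ.symm ⁻¹' W) :=
    ((contDiffOn_comp_symm hφ hf).fderiv_of_isOpen (isOpen_target_inter_preimage hW)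
      (by simp)).clm_apply contDiffOn_const
  exact (contMDiffOn_iff_contDiffOn.2 h1).comp ((contMDiffOn_of_mem_maximalAtlas hφ).mono hWφ)
    fun q hq ↦ mem_target_inter_preimage hWφ hq

theorem pd_add
    (hφ : φ ∈ IsManifold.maximalAtlas (𝓡 k) ∞ S) (hW : IsOpen W) (hWφ : W ⊆ φ.source)
    (hf : ContMDiffOn (𝓡 k) 𝓘(ℝ, ℝ) ∞ f W) (hg : ContMDiffOn (𝓡 k) 𝓘(ℝ, ℝ) ∞ g W) (hq : q ∈ W)
    (a : Fin k) : pd φ a (f + g) q = pd φ a f q + pd φ a g q := by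
  simp only [pd, Pi.add_apply]
  rw [fderiv_fun_add (differentiableAt_comp_symm hφ hW hWφ hf hq)
    (differentiableAt_comp_symm hφ hW hWφ hg hq)]
  rfl

theorem pd_mul
    (hφ : φ ∈ IsManifold.maximalAtlas (𝓡 k) ∞ S) (hW : IsOpen W) (hWφ : W ⊆ φ.source)
    (hf : ContMDiffOn (𝓡 k) 𝓘(ℝ, ℝ) ∞ f W) (hg : ContMDiffOn (𝓡 k) 𝓘(ℝ, ℝ) ∞ g W) (hq : q ∈ W)
    (a : Fin k) : pd φ a (f * g) q = pd φ a f q * g q + f q * pd φ a g q := by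
  simp only [pd, Pi.mul_apply]
  rw [fderiv_fun_mul (differentiableAt_comp_symm hφ hW hWφ hf hq)
    (differentiableAt_comp_symm hφ hW hWφ hg hq)]
  simp [φ.left_inv (hWφ hq)]
  ring

theorem pd_comm
    (hφ : φ ∈ IsManifold.maximalAtlas (𝓡 k) ∞ S) (hW : IsOpen W) (hWφ : W ⊆ φ.source)
    (hf : ContMDiffOn (𝓡 k) 𝓘(ℝ, ℝ) ∞ f W) (hq : q ∈ W) (a b : Fin k) :
    pd φ a (pd φ b f) q = pd φ b (pd φ a f) q := by
  have hc := contDiffAt_comp_symm hφ hW hWφ hf hq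
  have h1 : ∀ a b : Fin k, pd φ a (pd φ b f) q
      = fderiv ℝ (fderiv ℝ (fun y ↦ f (φ.symm y))) (φ q) (EuclideanSpace.single a 1)
        (EuclideanSpace.single b 1) := by
    intro a b
    have h2 : (fun y ↦ pd φ b f (φ.symm y)) =ᶠ[𝓝 (φ q)]
        fun y ↦ fderiv ℝ (fun y ↦ f (φ.symm y)) y (EuclideanSpace.single b 1) := by
      filter_upwards [φ.open_target.mem_nhds (φ.map_source (hWφ hq))] with y hy
      rw [pd, φ.right_inv hy]
    rw [pd, h2.fderiv_eq, fderiv_clm_apply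
      ((hc.fderiv_right (m := ∞) (by simp)).differentiableAt (by simp))
      (differentiableAt_const _)]
    simp
  rw [h1, h1]
  exact (hc.isSymmSndFDerivAt (by
    rw [minSmoothness_of_isRCLikeNormedField]
    exact WithTop.coe_le_coe.2 (le_top : (2 : ℕ∞) ≤ ⊤))) _ _

end PartialDerivative

/-! ### The differential ring of smooth functions on an open set -/

section SmoothFunctions

variable (k : ℕ) {S : Type*} [TopologicalSpace S] [ChartedSpace (EuclideanSpace ℝ (Fin k)) S]

/-- The ring of smooth functions on a subset of a manifold. -/
def SmoothOn (W : Set S) : Subalgebra ℝ (W → ℝ) where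
  carrier := {f | ∃ F : S → ℝ, ContMDiffOn (𝓡 k) 𝓘(ℝ, ℝ) ∞ F W ∧ ∀ q : W, F q = f q}
  mul_mem' := by
    rintro f g ⟨F, hF, h⟩ ⟨G, hG, h'⟩
    exact ⟨F * G, hF.mul hG, fun q ↦ by simp [h, h']⟩
  add_mem' := by
    rintro f g ⟨F, hF, h⟩ ⟨G, hG, h'⟩
    exact ⟨F + G, hF.add hG, fun q ↦ by simp [h, h']⟩
  algebraMap_mem' c := ⟨fun _ ↦ c, contMDiffOn_const, fun q ↦ rfl⟩

variable {k} {W : Set S}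

namespace SmoothOn

/-- The restriction of a function which is smooth on `W`. -/
def mk (F : S → ℝ) (hF : ContMDiffOn (𝓡 k) 𝓘(ℝ, ℝ) ∞ F W) : SmoothOn k W :=
  ⟨fun q ↦ F q, F, hF, fun _ ↦ rfl⟩

/-- Some function on the manifold that restricts to a given element of `SmoothOn k W`. -/
def lift (f : SmoothOn k W) : S → ℝ := f.2.choose

theorem contMDiffOn_lift (f : SmoothOn k W) : ContMDiffOn (𝓡 k) 𝓘(ℝ, ℝ) ∞ (lift f) W :=
  f.2.choose_spec.1

/-- Evaluation at a point. -/
def eval (q : W) : SmoothOn k W →+* ℝ :=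
  (Pi.evalRingHom (fun _ : W ↦ ℝ) q).comp (SmoothOn k W).val.toRingHom

theorem lift_apply (f : SmoothOn k W) (q : W) : lift f q = eval q f := f.2.choose_spec.2 q

@[simp]
theorem eval_mk (F : S → ℝ) (hF : ContMDiffOn (𝓡 k) 𝓘(ℝ, ℝ) ∞ F W) (q : W) :
    eval q (mk F hF) = F q := rfl

theorem ext_eval {f g : SmoothOn k W} (h : ∀ q, eval q f = eval q g) : f = g :=
  Subtype.ext (funext h)

theorem contMDiffOn_of_eval {F : S → ℝ} (f : SmoothOn k W) (h : ∀ q : W, F q = eval q f) :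
    ContMDiffOn (𝓡 k) 𝓘(ℝ, ℝ) ∞ F W :=
  (contMDiffOn_lift f).congr fun q hq ↦ (h ⟨q, hq⟩).trans (lift_apply f ⟨q, hq⟩).symm

variable {φ : OpenPartialHomeomorph S (EuclideanSpace ℝ (Fin k))}
  (hφ : φ ∈ IsManifold.maximalAtlas (𝓡 k) ∞ S) (hW : IsOpen W) (hWφ : W ⊆ φ.source)

/-- The partial derivative, as an operator on the ring of smooth functions. -/
def D (a : Fin k) : SmoothOn k W →+ SmoothOn k W :=
  AddMonoidHom.mk' (fun f ↦ mk (pd φ a (lift f)) (contMDiffOn_pd hφ hW hWφ (contMDiffOn_lift f) a))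
    fun f g ↦ by
      refine ext_eval fun q ↦ ?_
      rw [map_add, eval_mk, eval_mk, eval_mk,
        ← pd_add hφ hW hWφ (contMDiffOn_lift f) (contMDiffOn_lift g) q.2]
      refine pd_congr hW hWφ q.2 (fun x hx ↦ ?_) a
      simp [lift_apply _ ⟨x, hx⟩]

/-- `W` is open, so the partial derivative on `W` is determined by the values there, and the
extension chosen by `lift` is irrelevant. -/
theorem pd_eq_eval_D {F : S → ℝ} {f : SmoothOn k W} (h : ∀ q : W, F q = eval q f) (a : Fin k)
    (q : W) : pd φ a F q = eval q (D hφ hW hWφ a f) :=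
  pd_congr hW hWφ q.2 (fun x hx ↦ (h ⟨x, hx⟩).trans (lift_apply f ⟨x, hx⟩).symm) a

theorem D_mul (a : Fin k) (f g : SmoothOn k W) :
    D hφ hW hWφ a (f * g) = D hφ hW hWφ a f * g + f * D hφ hW hWφ a g := by
  refine ext_eval fun q ↦ ?_
  rw [← pd_eq_eval_D hφ hW hWφ (F := (lift f) * (lift g)) (fun q ↦ by simp [lift_apply]),
    pd_mul hφ hW hWφ (contMDiffOn_lift f) (contMDiffOn_lift g) q.2]
  simp only [map_add, map_mul, lift_apply]
  rw [pd_eq_eval_D hφ hW hWφ (fun q ↦ lift_apply f q), pd_eq_eval_D hφ hW hWφ (fun q ↦ lift_apply g q)]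

theorem D_comm (a b : Fin k) (f : SmoothOn k W) :
    D hφ hW hWφ a (D hφ hW hWφ b f) = D hφ hW hWφ b (D hφ hW hWφ a f) := by
  refine ext_eval fun q ↦ ?_
  rw [← pd_eq_eval_D hφ hW hWφ (F := pd φ b (lift f)) (fun q ↦ rfl),
    ← pd_eq_eval_D hφ hW hWφ (F := pd φ a (lift f)) (fun q ↦ rfl),
    pd_comm hφ hW hWφ (contMDiffOn_lift f) q.2]

end SmoothOn

/-- By Cramer's rule: determinant and adjugate are polynomial in the entries, hence computed in the
ring `SmoothOn k W`, and the determinant has no zero on `W`. -/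
theorem contMDiffOn_matrix_inv {ℓ : ℕ} {G : S → Matrix (Fin ℓ) (Fin ℓ) ℝ}
    (hG : ∀ i j, ContMDiffOn (𝓡 k) 𝓘(ℝ, ℝ) ∞ (fun q ↦ G q i j) W) (hdet : ∀ q ∈ W, (G q).det ≠ 0)
    (i j : Fin ℓ) : ContMDiffOn (𝓡 k) 𝓘(ℝ, ℝ) ∞ (fun q ↦ (G q)⁻¹ i j) W := by
  let G' : Matrix (Fin ℓ) (Fin ℓ) (SmoothOn k W) := Matrix.of fun i j ↦ SmoothOn.mk _ (hG i j)
  have hG' : ∀ q : W, (SmoothOn.eval q).mapMatrix G' = G q := fun q ↦ rfl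
  have h1 : ContMDiffOn (𝓡 k) 𝓘(ℝ, ℝ) ∞ (fun q ↦ (G q).det) W :=
    SmoothOn.contMDiffOn_of_eval G'.det fun q ↦ by rw [RingHom.map_det, hG']
  have h2 : ContMDiffOn (𝓡 k) 𝓘(ℝ, ℝ) ∞ (fun q ↦ (G q).adjugate i j) W :=
    SmoothOn.contMDiffOn_of_eval (G'.adjugate i j) fun q ↦ by
      rw [← hG', ← RingHom.map_adjugate]
      rfl
  refine ((h1.inv₀ hdet).mul h2).congr fun q _ ↦ ?_
  rw [Matrix.inv_def, Ring.inverse_eq_inv', Matrix.smul_apply, smul_eq_mul]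
  rfl

end SmoothFunctions

/-! ### The ambient metric in a chart -/

section Ambient

variable {m : ℕ} {M : Type*} [TopologicalSpace M] [ChartedSpace (EuclideanSpace ℝ (Fin m)) M]
  {ψ : OpenPartialHomeomorph M (EuclideanSpace ℝ (Fin m))} {q : M}

theorem mdifferentiable_chart (hψ : ψ ∈ IsManifold.maximalAtlas (𝓡 m) ∞ M) :
    ψ.MDifferentiable (𝓡 m) (𝓡 m) :=
  ⟨(contMDiffOn_of_mem_maximalAtlas hψ).mdifferentiableOn (by simp),
    (contMDiffOn_symm_of_mem_maximalAtlas hψ).mdifferentiableOn (by simp)⟩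

/-- The derivative of a chart, with values in the model space. -/
def chartDeriv (ψ : OpenPartialHomeomorph M (EuclideanSpace ℝ (Fin m))) (q : M)
    (v : TangentSpace (𝓡 m) q) : EuclideanSpace ℝ (Fin m) :=
  mfderiv (𝓡 m) (𝓡 m) ψ q v

/-- The derivative of the inverse of a chart, with values in the tangent space. -/
def chartDerivSymm (ψ : OpenPartialHomeomorph M (EuclideanSpace ℝ (Fin m))) (q : M) :
    EuclideanSpace ℝ (Fin m) →L[ℝ] TangentSpace (𝓡 m) q :=
  mfderiv (𝓡 m) (𝓡 m) ψ.symm (ψ q)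

theorem chartDerivSymm_chartDeriv (hψ : ψ ∈ IsManifold.maximalAtlas (𝓡 m) ∞ M)
    (hq : q ∈ ψ.source) (v : TangentSpace (𝓡 m) q) :
    chartDerivSymm ψ q (chartDeriv ψ q v) = v :=
  congrArg (fun L : TangentSpace (𝓡 m) q →L[ℝ] TangentSpace (𝓡 m) q ↦ L v)
    ((mdifferentiable_chart hψ).symm_comp_deriv hq)

theorem chartDeriv_chartDerivSymm (hψ : ψ ∈ IsManifold.maximalAtlas (𝓡 m) ∞ M)
    (hq : q ∈ ψ.source) (w : EuclideanSpace ℝ (Fin m)) :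
    chartDeriv ψ q (chartDerivSymm ψ q w) = w := by
  have h := (mdifferentiable_chart hψ).comp_symm_deriv (ψ.map_source hq)
  rw [ψ.left_inv hq] at h
  exact congrArg (fun L : EuclideanSpace ℝ (Fin m) →L[ℝ] EuclideanSpace ℝ (Fin m) ↦ L w) h

variable [IsManifold (𝓡 m) ∞ M] (η : PseudoMetric (m := m) M)

theorem metricMat_eq (hq : q ∈ ψ.source) (i j : Fin m) :
    metricMat η ψ q i j = η.form q (chartDerivSymm ψ q (EuclideanSpace.single i 1))
      (chartDerivSymm ψ q (EuclideanSpace.single j 1)) := by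
  -- The coordinate vectors are based at `ψ.symm (ψ q)`, equal to `q` only propositionally, so the
  -- base point is generalized first.
  have h : ∀ q' : M, q' = q → ∀ v w : EuclideanSpace ℝ (Fin m),
      η.form q' v w = η.form q v w := by
    rintro q' rfl v w
    rfl
  exact h _ (ψ.left_inv hq) _ _

theorem metricMat_symm (q : M) (i j : Fin m) : metricMat η ψ q i j = metricMat η ψ q j i :=
  η.symm _ _ _

theorem form_chartDerivSymm (hq : q ∈ ψ.source) (v w : EuclideanSpace ℝ (Fin m)) :
    η.form q (chartDerivSymm ψ q v) (chartDerivSymm ψ q w) = ip η ψ q v w := by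
  have h : ∀ v : EuclideanSpace ℝ (Fin m), v = ∑ i, v i • EuclideanSpace.single i (1 : ℝ) := by
    intro v
    simpa using ((EuclideanSpace.basisFun (Fin m) ℝ).sum_repr v).symm
  conv_lhs => rw [h v, h w]
  simp only [map_sum, map_smul, sum_apply, smul_apply,
    ip, metricMat_eq η hq, smul_eq_mul, Finset.mul_sum]
  refine Finset.sum_comm.trans ?_
  congr! 2
  ring

theorem form_eq_ip (hψ : ψ ∈ IsManifold.maximalAtlas (𝓡 m) ∞ M) (hq : q ∈ ψ.source)
    (v w : TangentSpace (𝓡 m) q) :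
    η.form q v w = ip η ψ q (chartDeriv ψ q v) (chartDeriv ψ q w) := by
  rw [← form_chartDerivSymm η hq, chartDerivSymm_chartDeriv hψ hq, chartDerivSymm_chartDeriv hψ hq]

theorem ip_eq_dotProduct (q : M) (v w : Fin m → ℝ) :
    ip η ψ q v w = (metricMat η ψ q).mulVec v ⬝ᵥ w := by
  simp only [ip, Matrix.mulVec, dotProduct, Finset.sum_mul]
  rw [Finset.sum_comm]
  simp only [metricMat_symm η q]

/-- A kernel vector of the matrix is the component vector of a tangent vector orthogonal to
everything, which nondegeneracy forces to be zero. -/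
theorem metricMat_det_ne_zero (hψ : ψ ∈ IsManifold.maximalAtlas (𝓡 m) ∞ M) (hq : q ∈ ψ.source) :
    (metricMat η ψ q).det ≠ 0 := by
  intro h
  obtain ⟨v, hv, h0⟩ := Matrix.exists_mulVec_eq_zero_iff.2 h
  refine hv ?_
  have h1 : chartDerivSymm ψ q (WithLp.toLp 2 v) = 0 := by
    refine η.nondegenerate q _ fun w ↦ ?_
    rw [form_eq_ip η hψ hq, chartDeriv_chartDerivSymm hψ hq, ip_eq_dotProduct, h0,
      zero_dotProduct]
  have h2 := chartDeriv_chartDerivSymm hψ hq (WithLp.toLp 2 v)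
  rw [h1] at h2
  have h3 : chartDeriv ψ q 0 = 0 := map_zero (mfderiv (𝓡 m) (𝓡 m) ψ q)
  rw [h3] at h2
  funext i
  exact congrArg (fun u : EuclideanSpace ℝ (Fin m) ↦ u i) h2.symm

/-- The coordinate fields are values of the tangent map of `ψ.symm` on constant fields, hence
smooth, and the smooth section `η.form` is evaluated on two of them. -/
theorem contMDiffOn_metricMat (hψ : ψ ∈ IsManifold.maximalAtlas (𝓡 m) ∞ M) (i j : Fin m) :
    ContMDiffOn (𝓡 m) 𝓘(ℝ, ℝ) ∞ (fun q ↦ metricMat η ψ q i j) ψ.source := by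
  have hs := contMDiffOn_symm_of_mem_maximalAtlas hψ
  have hv : ∀ i : Fin m, ContMDiffOn (𝓡 m) (𝓡 m).tangent ∞
      (fun y : EuclideanSpace ℝ (Fin m) ↦ (⟨ψ.symm y, mfderiv (𝓡 m) (𝓡 m) ψ.symm y
        (EuclideanSpace.single i (1 : ℝ) : EuclideanSpace ℝ (Fin m))⟩ : TangentBundle (𝓡 m) M))
      ψ.target := by
    intro i
    have h1 := hs.contMDiffOn_tangentMapWithin (m := ∞) (by simp)
      ψ.open_target.uniqueMDiffOn
    have h2 : ContMDiffOn (𝓡 m) (𝓡 m).tangent ∞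
        (fun y : EuclideanSpace ℝ (Fin m) ↦ (⟨y, (EuclideanSpace.single i (1 : ℝ) :
          EuclideanSpace ℝ (Fin m))⟩ : TangentBundle (𝓡 m) (EuclideanSpace ℝ (Fin m))))
        ψ.target :=
      contMDiffOn_vectorSpace_iff_contDiffOn.2 contDiffOn_const
    refine (h1.comp h2 fun y hy ↦ hy).congr fun y hy ↦ ?_
    simp only [tangentMapWithin, Function.comp, mfderivWithin_of_isOpen ψ.open_target hy]
  have h : ContMDiffOn (𝓡 m) 𝓘(ℝ, ℝ) ∞ (fun y : EuclideanSpace ℝ (Fin m) ↦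
      η.form (ψ.symm y)
        (mfderiv (𝓡 m) (𝓡 m) ψ.symm y
          (EuclideanSpace.single i (1 : ℝ) : EuclideanSpace ℝ (Fin m)))
        (mfderiv (𝓡 m) (𝓡 m) ψ.symm y
          (EuclideanSpace.single j (1 : ℝ) : EuclideanSpace ℝ (Fin m)))) ψ.target := by
    have := ContMDiffOn.clm_bundle_apply₂ (F₁ := EuclideanSpace ℝ (Fin m))
      (F₂ := EuclideanSpace ℝ (Fin m)) (F₃ := ℝ) (E₃ := Bundle.Trivial M ℝ)
      (η.contMDiff.comp_contMDiffOn hs) (hv i) (hv j)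
    intro y hy
    have h2 := this y hy
    simp only [Bundle.contMDiffWithinAt_totalSpace] at h2
    exact h2.2
  exact h.comp (contMDiffOn_of_mem_maximalAtlas hψ) fun q hq ↦ ψ.map_source hq

end Ambient

/-! ### Christoffel symbols and metric compatibility -/

section Christoffel

variable {m : ℕ} {M : Type*} [TopologicalSpace M] [ChartedSpace (EuclideanSpace ℝ (Fin m)) M]
  [IsManifold (𝓡 m) ∞ M] (η : PseudoMetric (m := m) M)
  {ψ : OpenPartialHomeomorph M (EuclideanSpace ℝ (Fin m))} {q : M}

theorem contMDiffOn_christoffel (hψ : ψ ∈ IsManifold.maximalAtlas (𝓡 m) ∞ M) (i j k : Fin m) :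
    ContMDiffOn (𝓡 m) 𝓘(ℝ, ℝ) ∞ (christoffel η ψ i j k) ψ.source := by
  have h1 := contMDiffOn_metricMat η hψ
  have h2 := contMDiffOn_matrix_inv h1 fun q hq ↦ metricMat_det_ne_zero η hψ hq
  have h3 : ∀ i j k : Fin m, ContMDiffOn (𝓡 m) 𝓘(ℝ, ℝ) ∞
      (pd ψ k fun q ↦ metricMat η ψ q i j) ψ.source := fun i j k ↦
    contMDiffOn_pd hψ ψ.open_source subset_rfl (h1 i j) k
  refine contMDiffOn_const.mul (contMDiffOn_finsetSum fun l _ ↦ ?_)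
  exact (h2 i l).mul (((h3 l k j).add (h3 l j k)).sub (h3 j k l))

theorem pd_metricMat_symm (i j k : Fin m) (q : M) :
    pd ψ k (fun q ↦ metricMat η ψ q i j) q = pd ψ k (fun q ↦ metricMat η ψ q j i) q := by
  simp only [metricMat_symm η _ i j]

theorem christoffel_symm (i j k : Fin m) (q : M) :
    christoffel η ψ i j k q = christoffel η ψ i k j q := by
  simp only [christoffel, pd_metricMat_symm η j k]
  congr! 3
  ring

theorem sum_metricMat_christoffel (hψ : ψ ∈ IsManifold.maximalAtlas (𝓡 m) ∞ M)
    (hq : q ∈ ψ.source) (p j k : Fin m) :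
    ∑ i, metricMat η ψ q p i * christoffel η ψ i j k q
      = (1 / 2) * (pd ψ j (fun q' ↦ metricMat η ψ q' p k) q
        + pd ψ k (fun q' ↦ metricMat η ψ q' p j) q - pd ψ p (fun q' ↦ metricMat η ψ q' j k) q) := by
  set c : Fin m → ℝ := fun l ↦ pd ψ j (fun q' ↦ metricMat η ψ q' l k) q
        + pd ψ k (fun q' ↦ metricMat η ψ q' l j) q - pd ψ l (fun q' ↦ metricMat η ψ q' j k) q
    with hc
  have h : (metricMat η ψ q).mulVec ((metricMat η ψ q)⁻¹.mulVec c) = c := by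
    rw [Matrix.mulVec_mulVec, Matrix.mul_nonsing_inv _
      (metricMat_det_ne_zero η hψ hq).isUnit, Matrix.one_mulVec]
  have h2 := congrFun h p
  calc ∑ i, metricMat η ψ q p i * christoffel η ψ i j k q
      = (1 / 2) * (metricMat η ψ q).mulVec ((metricMat η ψ q)⁻¹.mulVec c) p := by
        simp only [Matrix.mulVec, dotProduct, christoffel, Finset.mul_sum, hc]
        congr! 2
        ring
    _ = _ := by rw [h2]

/-- The Levi-Civita connection is compatible with the metric. -/
theorem pd_metricMat (hψ : ψ ∈ IsManifold.maximalAtlas (𝓡 m) ∞ M)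
    (hq : q ∈ ψ.source) (k i j : Fin m) :
    pd ψ k (fun q' ↦ metricMat η ψ q' i j) q
      = ∑ l, (metricMat η ψ q l j * christoffel η ψ l k i q
        + metricMat η ψ q i l * christoffel η ψ l k j q) := by
  have h1 := sum_metricMat_christoffel η hψ hq j k i
  have h2 := sum_metricMat_christoffel η hψ hq i k j
  rw [Finset.sum_add_distrib]
  simp only [metricMat_symm η q _ j]
  rw [h1, h2, pd_metricMat_symm η j i, pd_metricMat_symm η k i, pd_metricMat_symm η k j]
  ring

end Christoffel

/-! ### The immersion, its frame and its induced metric -/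

section Submanifold

variable {m n : ℕ} {M : Type*} [TopologicalSpace M] {S : Type*} [TopologicalSpace S]
  {ι : S → M} {ψ : OpenPartialHomeomorph M (EuclideanSpace ℝ (Fin m))}
  {φ : OpenPartialHomeomorph S (EuclideanSpace ℝ (Fin n))}

/-- The part of the domain of `φ` that `ι` maps to the domain of `ψ`. -/
def dom (ι : S → M) (ψ : OpenPartialHomeomorph M (EuclideanSpace ℝ (Fin m)))
    (φ : OpenPartialHomeomorph S (EuclideanSpace ℝ (Fin n))) : Set S :=
  φ.source ∩ ι ⁻¹' ψ.source

theorem dom_subset : dom ι ψ φ ⊆ φ.source := Set.inter_subset_left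

variable [ChartedSpace (EuclideanSpace ℝ (Fin m)) M] [ChartedSpace (EuclideanSpace ℝ (Fin n)) S]

theorem isOpen_dom (hι : ContMDiff (𝓡 n) (𝓡 m) ∞ ι) : IsOpen (dom ι ψ φ) :=
  φ.open_source.inter (ψ.open_source.preimage hι.continuous)

theorem contMDiffOn_chart_comp (hψ : ψ ∈ IsManifold.maximalAtlas (𝓡 m) ∞ M)
    (hι : ContMDiff (𝓡 n) (𝓡 m) ∞ ι) :
    ContMDiffOn (𝓡 n) 𝓘(ℝ, EuclideanSpace ℝ (Fin m)) ∞ (fun q ↦ ψ (ι q)) (dom ι ψ φ) :=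
  (contMDiffOn_of_mem_maximalAtlas hψ).comp hι.contMDiffOn fun _ hq ↦ hq.2

theorem contMDiffOn_apply {W : Set S} {F : S → EuclideanSpace ℝ (Fin m)}
    (hF : ContMDiffOn (𝓡 n) 𝓘(ℝ, EuclideanSpace ℝ (Fin m)) ∞ F W) (i : Fin m) :
    ContMDiffOn (𝓡 n) 𝓘(ℝ, ℝ) ∞ (fun q ↦ F q i) W :=
  (EuclideanSpace.proj (𝕜 := ℝ) i : EuclideanSpace ℝ (Fin m) →L[ℝ] ℝ).contDiff.contMDiff
    |>.comp_contMDiffOn hF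

theorem contMDiffOn_coordFun (hψ : ψ ∈ IsManifold.maximalAtlas (𝓡 m) ∞ M)
    (hι : ContMDiff (𝓡 n) (𝓡 m) ∞ ι) (i : Fin m) :
    ContMDiffOn (𝓡 n) 𝓘(ℝ, ℝ) ∞ (coordFun ι ψ i) (dom ι ψ φ) :=
  contMDiffOn_apply (contMDiffOn_chart_comp hψ hι) i

theorem contMDiffOn_frame (hψ : ψ ∈ IsManifold.maximalAtlas (𝓡 m) ∞ M)
    (hφ : φ ∈ IsManifold.maximalAtlas (𝓡 n) ∞ S)
    (hι : ContMDiff (𝓡 n) (𝓡 m) ∞ ι) (a : Fin n) (i : Fin m) :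
    ContMDiffOn (𝓡 n) 𝓘(ℝ, ℝ) ∞ (fun q ↦ frame ι ψ φ q a i) (dom ι ψ φ) :=
  contMDiffOn_pd hφ (isOpen_dom hι) dom_subset (contMDiffOn_coordFun hψ hι i) a

/-- The map `ι` in local coordinates is differentiable. -/
theorem differentiableAt_coord (hψ : ψ ∈ IsManifold.maximalAtlas (𝓡 m) ∞ M)
    (hφ : φ ∈ IsManifold.maximalAtlas (𝓡 n) ∞ S)
    (hι : ContMDiff (𝓡 n) (𝓡 m) ∞ ι) {q : S} (hq : q ∈ dom ι ψ φ) :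
    DifferentiableAt ℝ (fun y ↦ ψ (ι (φ.symm y))) (φ q) := by
  rw [differentiableAt_euclidean]
  intro i
  exact differentiableAt_comp_symm hφ (isOpen_dom hι) dom_subset (contMDiffOn_coordFun hψ hι i) hq

theorem fderiv_coord_apply (hψ : ψ ∈ IsManifold.maximalAtlas (𝓡 m) ∞ M)
    (hφ : φ ∈ IsManifold.maximalAtlas (𝓡 n) ∞ S)
    (hι : ContMDiff (𝓡 n) (𝓡 m) ∞ ι) {q : S} (hq : q ∈ dom ι ψ φ)
    (w : EuclideanSpace ℝ (Fin n)) (i : Fin m) :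
    fderiv ℝ (fun y ↦ ψ (ι (φ.symm y))) (φ q) w i = ∑ a, w a * frame ι ψ φ q a i := by
  have h1 : ∀ a, frame ι ψ φ q a i
      = fderiv ℝ (fun y ↦ ψ (ι (φ.symm y))) (φ q) (EuclideanSpace.single a 1) i := by
    intro a
    have := ((EuclideanSpace.proj (𝕜 := ℝ) i : EuclideanSpace ℝ (Fin m) →L[ℝ] ℝ).hasFDerivAt.comp
      (φ q) (differentiableAt_coord hψ hφ hι hq).hasFDerivAt).fderiv
    exact congrArg (fun L : EuclideanSpace ℝ (Fin n) →L[ℝ] ℝ ↦ L (EuclideanSpace.single a 1)) this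
  have h2 : w = ∑ a, w a • EuclideanSpace.single a (1 : ℝ) := by
    simpa using ((EuclideanSpace.basisFun (Fin n) ℝ).sum_repr w).symm
  conv_lhs => rw [h2]
  simp [h1]

/-- The chain rule for the restriction of a function to the submanifold. -/
theorem pd_comp (hψ : ψ ∈ IsManifold.maximalAtlas (𝓡 m) ∞ M)
    (hφ : φ ∈ IsManifold.maximalAtlas (𝓡 n) ∞ S)
    (hι : ContMDiff (𝓡 n) (𝓡 m) ∞ ι) {q : S} (hq : q ∈ dom ι ψ φ) {f : M → ℝ}
    (hf : ContMDiffOn (𝓡 m) 𝓘(ℝ, ℝ) ∞ f ψ.source) (a : Fin n) :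
    pd φ a (fun q ↦ f (ι q)) q = ∑ k, frame ι ψ φ q a k * pd ψ k f (ι q) := by
  have h1 : pd φ a (fun q ↦ f (ι q)) q = pd φ a (fun q ↦ f (ψ.symm (ψ (ι q)))) q :=
    pd_congr (isOpen_dom hι) dom_subset hq
      (fun x hx ↦ by simp only [ψ.left_inv (show ι x ∈ ψ.source from hx.2)]) a
  have hd : DifferentiableAt ℝ (fun y ↦ f (ψ.symm y)) (ψ (ι (φ.symm (φ q)))) := by
    rw [φ.left_inv hq.1]
    exact differentiableAt_comp_symm hψ ψ.open_source subset_rfl hf hq.2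
  have h2 := (hd.hasFDerivAt.comp (φ q) (differentiableAt_coord hψ hφ hι hq).hasFDerivAt).fderiv
  have h3 : ∀ w : EuclideanSpace ℝ (Fin m), w = ∑ k, w k • EuclideanSpace.single k (1 : ℝ) := by
    intro w
    simpa using ((EuclideanSpace.basisFun (Fin m) ℝ).sum_repr w).symm
  have h4 := congrArg
    (fun L : EuclideanSpace ℝ (Fin n) →L[ℝ] ℝ ↦ L (EuclideanSpace.single a 1)) h2
  rw [h1]
  refine h4.trans ?_
  rw [ContinuousLinearMap.comp_apply, h3 (fderiv ℝ (fun y ↦ ψ (ι (φ.symm y))) (φ q) _), map_sum]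
  refine Finset.sum_congr rfl fun k _ ↦ ?_
  rw [map_smul, fderiv_coord_apply hψ hφ hι hq, φ.left_inv hq.1, smul_eq_mul]
  congr 1
  simp [PiLp.single_apply]

/-- Near `q` the map `ψ ∘ ι` is also the coordinate expression of `ι` composed with `φ`; the chain
rule for both factorizations and uniqueness of the derivative give the formula. -/
theorem chartDeriv_mfderiv (hψ : ψ ∈ IsManifold.maximalAtlas (𝓡 m) ∞ M)
    (hφ : φ ∈ IsManifold.maximalAtlas (𝓡 n) ∞ S)
    (hι : ContMDiff (𝓡 n) (𝓡 m) ∞ ι) {q : S} (hq : q ∈ dom ι ψ φ) (v : TangentSpace (𝓡 n) q)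
    (i : Fin m) :
    chartDeriv ψ (ι q) (mfderiv (𝓡 n) (𝓡 m) ι q v) i
      = ∑ a, chartDeriv φ q v a * frame ι ψ φ q a i := by
  rw [← fderiv_coord_apply hψ hφ hι hq]
  have h1 : HasMFDerivAt (𝓡 n) (𝓡 m) (ψ ∘ ι) q
      ((mfderiv (𝓡 m) (𝓡 m) ψ (ι q)).comp (mfderiv (𝓡 n) (𝓡 m) ι q)) :=
    ((mdifferentiable_chart hψ).mdifferentiableAt hq.2).hasMFDerivAt.comp q
      (hι.mdifferentiableAt (by simp)).hasMFDerivAt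
  have h2 : HasMFDerivAt (𝓡 n) (𝓡 m) ((fun y ↦ ψ (ι (φ.symm y))) ∘ φ) q
      ((fderiv ℝ (fun y ↦ ψ (ι (φ.symm y))) (φ q)).comp (mfderiv (𝓡 n) (𝓡 n) φ q)) :=
    (differentiableAt_coord hψ hφ hι hq).hasFDerivAt.hasMFDerivAt.comp q
      ((mdifferentiable_chart hφ).mdifferentiableAt hq.1).hasMFDerivAt
  have h3 : ψ ∘ ι =ᶠ[𝓝 q] (fun y ↦ ψ (ι (φ.symm y))) ∘ φ := by
    filter_upwards [φ.open_source.mem_nhds hq.1] with x hx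
    simp [φ.left_inv hx]
  have h4 := hasMFDerivAt_unique h1 (h2.congr_of_eventuallyEq h3)
  exact congrArg (fun L : TangentSpace (𝓡 n) q →L[ℝ] EuclideanSpace ℝ (Fin m) ↦ L v i) h4

theorem contMDiffOn_comps [IsManifold (𝓡 m) ∞ M]
    (hψ : ψ ∈ IsManifold.maximalAtlas (𝓡 m) ∞ M) {V : ∀ p : S, TangentSpace (𝓡 m) (ι p)}
    (hV : IsSmoothAlong (n := n) ι V) (i : Fin m) :
    ContMDiffOn (𝓡 n) 𝓘(ℝ, ℝ) ∞ (fun q ↦ comps ι ψ V q i) (dom ι ψ φ) := by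
  have h1 := (contMDiffOn_of_mem_maximalAtlas hψ).contMDiffOn_tangentMapWithin (m := ∞) (by simp)
    ψ.open_source.uniqueMDiffOn
  have h2 := (contMDiff_snd_tangentBundle_modelSpace (n := ∞) (EuclideanSpace ℝ (Fin m))
    (𝓡 m)).comp_contMDiffOn (h1.comp (hV.contMDiffOn (s := dom ι ψ φ)) fun q hq ↦ hq.2)
  refine contMDiffOn_apply (h2.congr fun q hq ↦ ?_) i
  simp only [tangentMapWithin, Function.comp,
    mfderivWithin_of_isOpen ψ.open_source (show ι q ∈ ψ.source from hq.2)]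
  rfl

theorem comps_eq_of_isTangent (hψ : ψ ∈ IsManifold.maximalAtlas (𝓡 m) ∞ M)
    (hφ : φ ∈ IsManifold.maximalAtlas (𝓡 n) ∞ S)
    (hι : ContMDiff (𝓡 n) (𝓡 m) ∞ ι) {q : S} (hq : q ∈ dom ι ψ φ)
    {V : ∀ p : S, TangentSpace (𝓡 m) (ι p)} (hV : IsTangent (n := n) ι V) :
    ∃ c : Fin n → ℝ, ∀ i, comps ι ψ V q i = ∑ a, c a * frame ι ψ φ q a i := by
  obtain ⟨v, hv⟩ := hV q
  refine ⟨chartDeriv φ q v, fun i ↦ ?_⟩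
  rw [← chartDeriv_mfderiv hψ hφ hι hq, hv]
  rfl

theorem frame_eq_chartDeriv (hψ : ψ ∈ IsManifold.maximalAtlas (𝓡 m) ∞ M)
    (hφ : φ ∈ IsManifold.maximalAtlas (𝓡 n) ∞ S)
    (hι : ContMDiff (𝓡 n) (𝓡 m) ∞ ι) {q : S} (hq : q ∈ dom ι ψ φ) (a : Fin n) :
    frame ι ψ φ q a = chartDeriv ψ (ι q) (mfderiv (𝓡 n) (𝓡 m) ι q
      (chartDerivSymm φ q (EuclideanSpace.single a 1))) := by
  funext i
  rw [chartDeriv_mfderiv hψ hφ hι hq, chartDeriv_chartDerivSymm hφ hq.1]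
  simp [PiLp.single_apply]

variable [IsManifold (𝓡 m) ∞ M] (η : PseudoMetric (m := m) M)

theorem ip_frame_comps_of_isNormal (hψ : ψ ∈ IsManifold.maximalAtlas (𝓡 m) ∞ M)
    (hφ : φ ∈ IsManifold.maximalAtlas (𝓡 n) ∞ S)
    (hι : ContMDiff (𝓡 n) (𝓡 m) ∞ ι) {q : S} (hq : q ∈ dom ι ψ φ)
    {V : ∀ p : S, TangentSpace (𝓡 m) (ι p)} (hV : IsNormal (n := n) η ι V) (a : Fin n) :
    ip η ψ (ι q) (frame ι ψ φ q a) (comps ι ψ V q) = 0 := by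
  rw [frame_eq_chartDeriv hψ hφ hι hq]
  exact (form_eq_ip η hψ hq.2 _ _).symm.trans ((η.symm _ _ _).trans (hV q _))

theorem inducedMat_eq (hψ : ψ ∈ IsManifold.maximalAtlas (𝓡 m) ∞ M)
    (hφ : φ ∈ IsManifold.maximalAtlas (𝓡 n) ∞ S)
    (hι : ContMDiff (𝓡 n) (𝓡 m) ∞ ι) {q : S} (hq : q ∈ dom ι ψ φ) (a b : Fin n) :
    inducedMat η ι ψ φ q a b = η.form (ι q)
      (mfderiv (𝓡 n) (𝓡 m) ι q (chartDerivSymm φ q (EuclideanSpace.single a 1)))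
      (mfderiv (𝓡 n) (𝓡 m) ι q (chartDerivSymm φ q (EuclideanSpace.single b 1))) := by
  rw [form_eq_ip η hψ hq.2, ← frame_eq_chartDeriv hψ hφ hι hq, ← frame_eq_chartDeriv hψ hφ hι hq]
  rfl

/-- A left kernel vector `c` is the coordinate vector of a tangent vector of the submanifold that is
orthogonal to all others, so it vanishes by `hg`. -/
theorem inducedMat_det_ne_zero (hψ : ψ ∈ IsManifold.maximalAtlas (𝓡 m) ∞ M)
    (hφ : φ ∈ IsManifold.maximalAtlas (𝓡 n) ∞ S)
    (hι : ContMDiff (𝓡 n) (𝓡 m) ∞ ι) (hg : InducedNondegenerate (n := n) η ι)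
    {q : S} (hq : q ∈ dom ι ψ φ) : (inducedMat η ι ψ φ q).det ≠ 0 := by
  intro h
  obtain ⟨c, hc, h0⟩ := Matrix.exists_vecMul_eq_zero_iff.2 h
  refine hc ?_
  have hsum : ∀ w : EuclideanSpace ℝ (Fin n), w = ∑ a, w a • EuclideanSpace.single a (1 : ℝ) := by
    intro w
    simpa using ((EuclideanSpace.basisFun (Fin n) ℝ).sum_repr w).symm
  have h1 : chartDerivSymm φ q (WithLp.toLp 2 c) = 0 := by
    refine hg q _ fun w ↦ ?_
    rw [← chartDerivSymm_chartDeriv hφ hq.1 w, hsum (WithLp.toLp 2 c), hsum (chartDeriv φ q w)]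
    simp only [map_sum, map_smul, sum_apply, smul_apply, smul_eq_mul,
      ← inducedMat_eq η hψ hφ hι hq]
    refine Finset.sum_eq_zero fun b _ ↦ ?_
    have h2 : ∑ a, c a * inducedMat η ι ψ φ q a b = 0 := congrFun h0 b
    rw [h2, mul_zero]
  have h2 := chartDeriv_chartDerivSymm hφ hq.1 (WithLp.toLp 2 c)
  rw [h1] at h2
  have h3 : chartDeriv φ q 0 = 0 := map_zero (mfderiv (𝓡 n) (𝓡 n) φ q)
  rw [h3] at h2
  funext i
  exact congrArg (fun u : EuclideanSpace ℝ (Fin n) ↦ u i) h2.symm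

end Submanifold

/-! ### The bracket as a first order differential operator -/

section Bracket

variable {n r : ℕ} {S : Type*} [TopologicalSpace S] [ChartedSpace (EuclideanSpace ℝ (Fin n)) S]

/-- A function which is smooth near a point agrees near this point with a smooth function. -/
theorem exists_smooth_eventuallyEq [T2Space S] [IsManifold (𝓡 n) ∞ S] {W : Set S} (hW : IsOpen W)
    {q : S} (hq : q ∈ W) {f : S → ℝ} (hf : ContMDiffOn (𝓡 n) 𝓘(ℝ, ℝ) ∞ f W) :
    ∃ F : C^∞⟮𝓡 n, S; ℝ⟯, (F : S → ℝ) =ᶠ[𝓝 q] f := by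
  obtain ⟨χ, -, hχ⟩ := (SmoothBumpFunction.nhds_basis_tsupport (I := 𝓡 n) q).mem_iff.1
    (hW.mem_nhds hq)
  have hs : ContMDiff (𝓡 n) 𝓘(ℝ, ℝ) ∞ fun x ↦ χ x * f x := by
    refine contMDiff_of_tsupport fun x hx ↦ ?_
    have hx' : x ∈ W := hχ (tsupport_mul_subset_left hx)
    exact χ.contMDiff.contMDiffAt.mul (hf.contMDiffAt (hW.mem_nhds hx'))
  refine ⟨⟨_, hs⟩, ?_⟩
  filter_upwards [χ.eventuallyEq_one] with x hx
  change χ x * f x = f x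
  simp [hx]

/-- A local derivation at a point is a combination of partial derivatives. -/
theorem exists_derivation_eq_sum_pd [T2Space S] [IsManifold (𝓡 n) ∞ S]
    {φ : OpenPartialHomeomorph S (EuclideanSpace ℝ (Fin n))}
    (hφ : φ ∈ IsManifold.maximalAtlas (𝓡 n) ∞ S) {q : S} (hq : q ∈ φ.source)
    (δ : C^∞⟮𝓡 n, S; ℝ⟯ →ₗ[ℝ] ℝ) (hmul : ∀ f g, δ (f * g) = f q * δ g + g q * δ f)
    (hloc : ∀ f g : C^∞⟮𝓡 n, S; ℝ⟯, (f : S → ℝ) =ᶠ[𝓝 q] g → δ f = δ g) :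
    ∃ c : Fin n → ℝ, ∀ f : C^∞⟮𝓡 n, S; ℝ⟯, δ f = ∑ a, c a * pd φ a f q := by
  have hφs := contMDiffOn_of_mem_maximalAtlas hφ
  have hU : ∀ a : Fin n, ContMDiffOn (𝓡 n) 𝓘(ℝ, ℝ) ∞ (fun x ↦ φ x a - φ q a) φ.source :=
    fun a ↦ (contMDiffOn_apply hφs a).sub contMDiffOn_const
  choose U hU' using fun a ↦ exists_smooth_eventuallyEq φ.open_source hq (hU a)
  refine ⟨fun a ↦ δ (U a), fun f ↦ ?_⟩
  have hf : ContMDiffOn (𝓡 n) 𝓘(ℝ, ℝ) ∞ (fun y ↦ f (φ.symm y)) φ.target :=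
    f.contMDiff.comp_contMDiffOn (contMDiffOn_symm_of_mem_maximalAtlas hφ)
  -- Hadamard's lemma needs a function on the whole model space, so `f ∘ φ.symm` is replaced by a
  -- global smooth function with the same germ at `φ q`.
  obtain ⟨G, hG⟩ := exists_smooth_eventuallyEq (n := n) φ.open_target (φ.map_source hq) hf
  obtain ⟨h, hh, hh0, hGh⟩ := exists_hadamard G.contMDiff.contDiff (φ q)
  have hH : ∀ a : Fin n, ContMDiffOn (𝓡 n) 𝓘(ℝ, ℝ) ∞
      (fun x ↦ h (φ x) (EuclideanSpace.single a 1)) φ.source := fun a ↦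
    (hh.clm_apply contDiff_const).contMDiff.comp_contMDiffOn hφs
  choose H hH' using fun a ↦ exists_smooth_eventuallyEq φ.open_source hq (hH a)
  have hsum : ∀ w : EuclideanSpace ℝ (Fin n), w = ∑ a, w a • EuclideanSpace.single a (1 : ℝ) := by
    intro w
    simpa using ((EuclideanSpace.basisFun (Fin n) ℝ).sum_repr w).symm
  -- Hadamard's expansion near `q`: `U a` is the germ of the centred coordinate, `H a` that of the
  -- cofactor, with `H a q = ∂ₐ f (q)`. Locality of `δ` allows `f` to be replaced by it.
  have hfeq : (f : S → ℝ) =ᶠ[𝓝 q] (f q • (1 : C^∞⟮𝓡 n, S; ℝ⟯) + ∑ a, U a * H a :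
      C^∞⟮𝓡 n, S; ℝ⟯) := by
    have e1 : ∀ᶠ x in 𝓝 q, G (φ x) = f (φ.symm (φ x)) :=
      (φ.continuousAt hq).eventually hG
    filter_upwards [e1, φ.open_source.mem_nhds hq, Filter.eventually_all.2 hU',
      Filter.eventually_all.2 hH'] with x hx1 hx2 hx3 hx4
    rw [φ.left_inv hx2] at hx1
    have e2 : G (φ q) = f q := by
      exact hG.self_of_nhds.trans (congrArg f (φ.left_inv hq))
    have e3 : (f q • (1 : C^∞⟮𝓡 n, S; ℝ⟯) + ∑ a, U a * H a : C^∞⟮𝓡 n, S; ℝ⟯) x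
        = f q + ∑ a, U a x * H a x := by
      have : ∀ s : Finset (Fin n), (∑ a ∈ s, U a * H a : C^∞⟮𝓡 n, S; ℝ⟯) x
          = ∑ a ∈ s, U a x * H a x := fun s ↦
        map_sum ((Pi.evalRingHom (fun _ : S ↦ ℝ) x).comp
          (ContMDiffMap.coeFnRingHom (I := 𝓡 n) (N := S) (I' := 𝓘(ℝ, ℝ)) (n := ∞) (R := ℝ))) _ _
      simp [this]
    rw [e3, ← hx1, hGh, e2, hsum (φ x - φ q), map_sum]
    congr 1
    refine Finset.sum_congr rfl fun a _ ↦ ?_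
    rw [map_smul, hx3, hx4, smul_eq_mul]
    rfl
  have hone : δ 1 = 0 := by
    have := hmul 1 1
    simpa using this
  rw [hloc _ _ hfeq, map_add, map_smul, hone, smul_zero, zero_add, map_sum]
  refine Finset.sum_congr rfl fun a _ ↦ ?_
  have e4 : U a q = 0 := (hU' a).self_of_nhds.trans (sub_self _)
  have e5 : H a q = h (φ q) (EuclideanSpace.single a 1) := (hH' a).self_of_nhds
  -- Since `U a` vanishes at `q`, the Leibniz rule keeps only `H a q * δ (U a)`.
  rw [hmul, e4, zero_mul, zero_add, mul_comm, e5, hh0, pd, hG.fderiv_eq]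

/-- The bracket is a first order differential operator in its first argument. -/
theorem exists_bracketAt_cons [T2Space S] [IsManifold (𝓡 n) ∞ S]
    {br : MultilinearMap ℝ (fun _ : Fin (r + 1) ↦ C^∞⟮𝓡 n, S; ℝ⟯) C^∞⟮𝓡 n, S; ℝ⟯}
    (hbr : IsMultiDerivation br) {φ : OpenPartialHomeomorph S (EuclideanSpace ℝ (Fin n))}
    (hφ : φ ∈ IsManifold.maximalAtlas (𝓡 n) ∞ S) {W : Set S} (hW : IsOpen W)
    (hWφ : W ⊆ φ.source) {q : S} (hq : q ∈ W) {h : Fin r → S → ℝ}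
    (hh : ∀ k, ContMDiffOn (𝓡 n) 𝓘(ℝ, ℝ) ∞ (h k) W) :
    ∃ c : Fin n → ℝ, ∀ f : S → ℝ, ContMDiffOn (𝓡 n) 𝓘(ℝ, ℝ) ∞ f W →
      bracketAt br (Fin.cons f h : Fin (r + 1) → S → ℝ) q = ∑ a, c a * pd φ a f q := by
  choose H hH using fun k ↦ exists_smooth_eventuallyEq hW hq (hh k)
  -- With the other arguments frozen, evaluation of the bracket at `q` is a derivation there. The
  -- coefficients therefore do not depend on `f`.
  let δ : C^∞⟮𝓡 n, S; ℝ⟯ →ₗ[ℝ] ℝ :=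
    { toFun f := br (Fin.cons f H) q
      map_add' f g := by
        rw [br.cons_add]
        rfl
      map_smul' c f := by
        rw [br.cons_smul]
        rfl }
  obtain ⟨c, hc⟩ := exists_derivation_eq_sum_pd hφ (hWφ hq) δ
    (fun f g ↦ by
      have := hbr (Fin.cons f H) 0 f g
      rw [Fin.update_cons_zero, Fin.update_cons_zero, Fin.update_cons_zero] at this
      exact congrArg (fun F : C^∞⟮𝓡 n, S; ℝ⟯ ↦ F q) this)
    (fun f g hfg ↦ bracket_congr hbr _ _ q fun k ↦ by
      refine Fin.cases ?_ (fun k ↦ ?_) k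
      · exact hfg
      · exact Filter.EventuallyEq.rfl)
  refine ⟨c, fun f hf ↦ ?_⟩
  obtain ⟨F, hF⟩ := exists_smooth_eventuallyEq hW hq hf
  rw [bracketAt_eq hbr _ (Fin.cons F H) q fun k ↦ by
    refine Fin.cases ?_ (fun k ↦ ?_) k
    · exact hF
    · exact hH k]
  refine (hc F).trans (Finset.sum_congr rfl fun a _ ↦ ?_)
  rw [pd_congr_nhds (hWφ hq) hF]

end Bracket

/-! ### The tensor `ℬ_N` and its Codazzi equations in components -/

namespace CoordFrame

variable {A : Type*} [CommRing A] {m n : ℕ} (C : CoordFrame A m n)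

theorem ginv_symm (a b : Fin n) : C.ginv a b = C.ginv b a := by
  set g : Matrix (Fin n) (Fin n) A :=
    Matrix.of (fun a b ↦ ∑ i, ∑ j, C.G i j * C.e a i * C.e b j) with hg
  have hsymm : g.transpose = g := by
    ext a b
    exact C.metric_symm (C.e b) (C.e a)
  have h1 : C.ginv * g = 1 := C.ginv_mul
  have h2 : g * C.ginv.transpose = 1 := by
    have := congrArg Matrix.transpose h1
    rwa [Matrix.transpose_mul, hsymm, Matrix.transpose_one] at this
  have h3 : C.ginv = C.ginv.transpose := left_inv_eq_right_inv h1 h2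
  exact congrFun (congrFun h3 a) b

/-- Raising an index of a covariant object on the submanifold. -/
def raise (t : Fin n → A) (i : Fin m) : A := ∑ a, ∑ b, C.ginv a b * C.e a i * t b

/-- The bridge between the two formalisms: contracting `g^{ab} e_a^i t_b` with `v_i` yields `t`
along the tangential part of `v`. With `t` a covariant derivative, this turns `v_i ∇̂^i` into `∇̄_v`
for tangent `v`. -/
theorem sum_low_raise (v : Fin m → A) (t : Fin n → A) :
    ∑ i, C.low v i * C.raise t i = ∑ b, C.toFrameConnection.coef v b * t b := by
  simp only [FrameConnection.coef, toFrameConnection_ginv, toFrameConnection_metric,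
    toFrameConnection_e, metric_eq_low, raise, Finset.sum_mul, Finset.mul_sum]
  rw [Finset.sum_comm]
  refine (Finset.sum_congr rfl fun a _ ↦ Finset.sum_comm).trans ?_
  rw [Finset.sum_comm]
  refine Finset.sum_congr rfl fun b _ ↦ Finset.sum_congr rfl fun a _ ↦
    Finset.sum_congr rfl fun i _ ↦ ?_
  rw [C.ginv_symm a b]
  ring

/-- The components of the tensor `ℬ_N`. -/
def tensorB (N : Fin m → A) (i j : Fin m) : A := - C.raise (fun b ↦ C.conn b N j) i

theorem pair_tensorB (N v w : Fin m → A) :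
    C.pair (C.tensorB N) v w = C.toFrameConnection.weingarten N v w := by
  have h := fun j ↦ C.sum_low_raise v (fun b ↦ C.conn b N j)
  have h1 : C.pair (C.tensorB N) v w
      = - ∑ j, (∑ i, C.low v i * C.raise (fun b ↦ C.conn b N j) i) * C.low w j := by
    simp only [pair, tensorB, Finset.sum_mul]
    rw [Finset.sum_comm, ← Finset.sum_neg_distrib]
    refine Finset.sum_congr rfl fun j _ ↦ ?_
    rw [← Finset.sum_neg_distrib]
    refine Finset.sum_congr rfl fun i _ ↦ ?_
    ring
  rw [h1]
  simp only [h, FrameConnection.weingarten, toFrameConnection_metric, toFrameConnection_conn,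
    metric_eq_low, Finset.sum_mul, Finset.mul_sum]
  rw [Finset.sum_comm]
  simp only [mul_assoc]

/-- The covariant derivative `∇̂` of a contravariant two-tensor. -/
def hatConn₂ (T : Fin m → Fin m → A) (k i j : Fin m) : A := C.raise (fun b ↦ C.conn₂ b T i j) k

/-- `sum_low_raise` converts the first contraction into a derivative along `u`, and `sum_conn₂` is
the Leibniz rule for the other two. -/
theorem sum_hatConn₂ (T : Fin m → Fin m → A) (u v w : Fin m → A) :
    ∑ k, ∑ i, ∑ j, C.low u k * C.low v i * C.low w j * C.hatConn₂ T k i j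
      = C.toFrameConnection.derivAlong (C.toFrameConnection.coef u) (C.pair T v w)
        - C.pair T (C.toFrameConnection.along (C.toFrameConnection.coef u) v) w
        - C.pair T v (C.toFrameConnection.along (C.toFrameConnection.coef u) w) := by
  have h1 : ∑ k, ∑ i, ∑ j, C.low u k * C.low v i * C.low w j * C.hatConn₂ T k i j
      = ∑ i, ∑ j, C.low v i * C.low w j *
        ∑ k, C.low u k * C.raise (fun b ↦ C.conn₂ b T i j) k := by
    rw [Finset.sum_comm]
    refine Finset.sum_congr rfl fun i _ ↦ ?_
    rw [Finset.sum_comm]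
    simp only [Finset.mul_sum]
    refine Finset.sum_congr rfl fun j _ ↦ Finset.sum_congr rfl fun k _ ↦ ?_
    rw [hatConn₂]
    ring
  have h2 : ∑ i, ∑ j, C.low v i * C.low w j *
        ∑ k, C.low u k * C.raise (fun b ↦ C.conn₂ b T i j) k
      = ∑ b, C.toFrameConnection.coef u b *
        ∑ i, ∑ j, C.low v i * C.low w j * C.conn₂ b T i j := by
    simp only [sum_low_raise, Finset.mul_sum]
    refine (Finset.sum_congr rfl fun i _ ↦ Finset.sum_comm).trans ?_
    rw [Finset.sum_comm]
    refine Finset.sum_congr rfl fun b _ ↦ Finset.sum_congr rfl fun i _ ↦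
      Finset.sum_congr rfl fun j _ ↦ ?_
    ring
  have h3 : ∀ (x : Fin n → A) (V : Fin n → Fin m → A),
      C.pair T (∑ b, x b • V b) w = ∑ b, x b * C.pair T (V b) w := by
    intro x V
    have h : ∀ i, C.low (∑ b, x b • V b) i = ∑ b, x b * C.low (V b) i := by
      intro i
      simp only [low, Finset.sum_apply, Pi.smul_apply, smul_eq_mul, Finset.mul_sum]
      rw [Finset.sum_comm]
      congr! 2
      ring
    simp only [pair, h, Finset.mul_sum, Finset.sum_mul]
    refine (Finset.sum_congr rfl fun i _ ↦ Finset.sum_comm).trans ?_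
    rw [Finset.sum_comm]
    congr! 3
    ring
  have h4 : ∀ (x : Fin n → A) (V : Fin n → Fin m → A),
      C.pair T v (∑ b, x b • V b) = ∑ b, x b * C.pair T v (V b) := by
    intro x V
    have h : ∀ i, C.low (∑ b, x b • V b) i = ∑ b, x b * C.low (V b) i := by
      intro i
      simp only [low, Finset.sum_apply, Pi.smul_apply, smul_eq_mul, Finset.mul_sum]
      rw [Finset.sum_comm]
      congr! 2
      ring
    simp only [pair, h, Finset.mul_sum]
    refine (Finset.sum_congr rfl fun i _ ↦ Finset.sum_comm).trans ?_
    rw [Finset.sum_comm]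
    congr! 3
    ring
  rw [h1, h2]
  simp only [C.sum_conn₂, FrameConnection.derivAlong, FrameConnection.along, h3, h4,
    toFrameConnection_D, toFrameConnection_conn, ← Finset.sum_sub_distrib, ← mul_sub]

/-- The map `ℬ_N`. -/
def mapB (N v : Fin m → A) (i : Fin m) : A := ∑ j, C.tensorB N i j * C.low v j

/-- The arguments change places: `ℬ_N` as a map contracts the second index, so the vector paired
with its value lands in the first slot, that of the differentiation. -/
theorem metric_mapB (N v w : Fin m → A) :
    C.metric (C.mapB N v) w = C.toFrameConnection.weingarten N w v := by
  rw [← C.pair_tensorB, metric_eq_low]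
  simp only [mapB, pair, Finset.sum_mul]
  congr! 2
  ring

/-- The Codazzi equation in components. -/
theorem codazzi_tensorB {x y : Fin m → A}
    (hx : C.toFrameConnection.vec (C.toFrameConnection.coef x) = x)
    (hy : C.toFrameConnection.vec (C.toFrameConnection.coef y) = y) (z N : Fin m → A) :
    ∑ i, ∑ j, ∑ l, C.low x i * C.low y j * C.low z l *
        (C.hatConn₂ (C.tensorB N) i j l - C.hatConn₂ (C.tensorB N) j i l)
      = C.metric (C.toFrameConnection.riem (C.toFrameConnection.coef x)
          (C.toFrameConnection.coef y) z) N := by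
  have h := C.toFrameConnection.weingarten_deriv_sub (C.toFrameConnection.coef x)
    (C.toFrameConnection.coef y) z N
  rw [hx, hy] at h
  refine Eq.trans ?_ h
  simp only [← C.pair_tensorB]
  rw [← C.sum_hatConn₂, ← C.sum_hatConn₂]
  simp only [mul_sub, Finset.sum_sub_distrib]
  congr 1
  rw [Finset.sum_comm]
  congr! 3
  ring

/-- The Codazzi equation for the covariant derivative of the maps `ℬ_N`. -/
theorem codazzi_mapB {x y : Fin m → A}
    (hx : C.toFrameConnection.vec (C.toFrameConnection.coef x) = x)
    (hy : C.toFrameConnection.vec (C.toFrameConnection.coef y) = y) (z N : Fin m → A) :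
    C.metric (C.toFrameConnection.along (C.toFrameConnection.coef x) (C.mapB N z)
        - C.mapB N (C.toFrameConnection.along (C.toFrameConnection.coef x) z)) y
      - C.metric (C.toFrameConnection.along (C.toFrameConnection.coef y) (C.mapB N z)
        - C.mapB N (C.toFrameConnection.along (C.toFrameConnection.coef y) z)) x
      = C.metric (C.toFrameConnection.riem (C.toFrameConnection.coef x)
          (C.toFrameConnection.coef y) z) N := by
  have h := C.toFrameConnection.weingarten_deriv_sub (C.toFrameConnection.coef x)
    (C.toFrameConnection.coef y) z N
  rw [hx, hy] at h
  refine Eq.trans ?_ h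
  have h1 := C.toFrameConnection.derivAlong_metric (C.toFrameConnection.coef x) (C.mapB N z) y
  have h2 := C.toFrameConnection.derivAlong_metric (C.toFrameConnection.coef y) (C.mapB N z) x
  simp only [toFrameConnection_metric, metric_mapB] at h1 h2
  simp only [map_sub, LinearMap.sub_apply, metric_mapB]
  -- Metric compatibility rewrites `⟨∇̄_x (ℬ_N z), y⟩` as a derivative of `weingarten N y z` minus a
  -- term with `∇̄_x y`, which is the shape of `weingarten_deriv_sub`.
  linear_combination -h1 + h2

end CoordFrame

/-! ### The operators `𝒟^i` as the gradient, and the `CoordFrame` of the submanifold -/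

section Submanifold

variable {m n r : ℕ} {M : Type*} [TopologicalSpace M] [ChartedSpace (EuclideanSpace ℝ (Fin m)) M]
  [IsManifold (𝓡 m) ∞ M] (η : PseudoMetric (m := m) M)
  {S : Type*} [TopologicalSpace S]
  {ι : S → M} {ψ : OpenPartialHomeomorph M (EuclideanSpace ℝ (Fin m))}
  {φ : OpenPartialHomeomorph S (EuclideanSpace ℝ (Fin n))}

theorem inducedMat_mulVec (q : S) (c : Fin n → ℝ) : (inducedMat η ι ψ φ q).mulVec c
    = fun a ↦ ip η ψ (ι q) (frame ι ψ φ q a) (fun i ↦ ∑ b, c b * frame ι ψ φ q b i) := by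
  funext a
  simp only [Matrix.mulVec, dotProduct, inducedMat, Matrix.of_apply, ip, Finset.sum_mul,
    Finset.mul_sum]
  rw [Finset.sum_comm]
  refine Finset.sum_congr rfl fun i _ ↦ ?_
  rw [Finset.sum_comm]
  congr! 2
  ring

variable [ChartedSpace (EuclideanSpace ℝ (Fin n)) S]

/-- The vectors of the coordinate frame are linearly independent. -/
theorem eq_of_sum_frame_eq (hψ : ψ ∈ IsManifold.maximalAtlas (𝓡 m) ∞ M)
    (hφ : φ ∈ IsManifold.maximalAtlas (𝓡 n) ∞ S) (hι : ContMDiff (𝓡 n) (𝓡 m) ∞ ι)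
    (hg : InducedNondegenerate (n := n) η ι) {q : S} (hq : q ∈ dom ι ψ φ) {c d : Fin n → ℝ}
    (h : ∀ i, ∑ b, c b * frame ι ψ φ q b i = ∑ b, d b * frame ι ψ φ q b i) : c = d := by
  have h2 : (inducedMat η ι ψ φ q).mulVec c = (inducedMat η ι ψ φ q).mulVec d := by
    rw [inducedMat_mulVec, inducedMat_mulVec, funext h]
  exact Matrix.mulVec_injective_of_isUnit ((Matrix.isUnit_iff_isUnit_det _).2
    (inducedMat_det_ne_zero η hψ hφ hι hg hq).isUnit) h2

/-- A combination of the vectors of the coordinate frame is its own tangential component. -/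
theorem tanPart_eq_self (hψ : ψ ∈ IsManifold.maximalAtlas (𝓡 m) ∞ M)
    (hφ : φ ∈ IsManifold.maximalAtlas (𝓡 n) ∞ S) (hι : ContMDiff (𝓡 n) (𝓡 m) ∞ ι)
    (hg : InducedNondegenerate (n := n) η ι) {q : S} (hq : q ∈ dom ι ψ φ) {c : Fin n → ℝ}
    {V : S → Fin m → ℝ} (hV : ∀ i, V q i = ∑ a, c a * frame ι ψ φ q a i) (i : Fin m) :
    tanPart η ι ψ φ V q i = ∑ a, c a * frame ι ψ φ q a i := by
  have h1 : (fun a ↦ ip η ψ (ι q) (frame ι ψ φ q a) (V q)) = (inducedMat η ι ψ φ q).mulVec c := by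
    rw [inducedMat_mulVec, ← funext hV]
  have h2 : tanCoeff η ι ψ φ V q = c := by
    have h3 : tanCoeff η ι ψ φ V q = (inducedMat η ι ψ φ q)⁻¹.mulVec
        (fun a ↦ ip η ψ (ι q) (frame ι ψ φ q a) (V q)) := rfl
    rw [h3, h1, Matrix.mulVec_mulVec, Matrix.nonsing_inv_mul _
      (inducedMat_det_ne_zero η hψ hφ hι hg hq).isUnit, Matrix.one_mulVec]
  rw [tanPart, h2]

theorem sq_eq_one_of_sign {ε : ℝ} (hε : ε = 1 ∨ ε = -1) : ε * ε = 1 := by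
  rcases hε with rfl | rfl <;> norm_num

/-- The prefactor `ε / γ²` cancels the `ε γ²` of the compatibility condition because `ε² = 1`. -/
theorem projD_eq (hψ : ψ ∈ IsManifold.maximalAtlas (𝓡 m) ∞ M)
    (hφ : φ ∈ IsManifold.maximalAtlas (𝓡 n) ∞ S)
    {br : MultilinearMap ℝ (fun _ : Fin (r + 1) ↦ C^∞⟮𝓡 n, S; ℝ⟯) C^∞⟮𝓡 n, S; ℝ⟯}
    {ε : ℝ} (hε : ε = 1 ∨ ε = -1) {γ : C^∞⟮𝓡 n, S; ℝ⟯} (hγ : ∀ p, 0 < γ p)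
    (hcompat : IsCompatible η ι br ε γ) {q : S} (hq : q ∈ dom ι ψ φ) (i j : Fin m) :
    projD η ι ψ br ε γ i j q
      = ∑ a, ∑ b, (inducedMat η ι ψ φ q)⁻¹ a b * frame ι ψ φ q a i * frame ι ψ φ q b j := by
  rw [projD, hcompat ψ hψ φ hφ q hq.1 hq.2, ← mul_assoc]
  have h : ε / γ q ^ 2 * (ε * γ q ^ 2) = 1 := by
    have := (hγ q).ne'
    field_simp
    rw [pow_two, sq_eq_one_of_sign hε]
  rw [h, one_mul]

/-- The operators `𝒟^i` are the components of the gradient. -/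
theorem derivD_eq [T2Space S] [IsManifold (𝓡 n) ∞ S]
    (hψ : ψ ∈ IsManifold.maximalAtlas (𝓡 m) ∞ M)
    (hφ : φ ∈ IsManifold.maximalAtlas (𝓡 n) ∞ S) (hι : ContMDiff (𝓡 n) (𝓡 m) ∞ ι)
    (hg : InducedNondegenerate (n := n) η ι)
    {br : MultilinearMap ℝ (fun _ : Fin (r + 1) ↦ C^∞⟮𝓡 n, S; ℝ⟯) C^∞⟮𝓡 n, S; ℝ⟯}
    (hbr : IsMultiDerivation br)
    {ε : ℝ} (hε : ε = 1 ∨ ε = -1) {γ : C^∞⟮𝓡 n, S; ℝ⟯} (hγ : ∀ p, 0 < γ p)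
    (hcompat : IsCompatible η ι br ε γ) {q : S} (hq : q ∈ dom ι ψ φ) (i : Fin m) {f : S → ℝ}
    (hf : ContMDiffOn (𝓡 n) 𝓘(ℝ, ℝ) ∞ f (dom ι ψ φ)) :
    derivD η ι ψ br ε γ i f q
      = ∑ a, ∑ b, (inducedMat η ι ψ φ q)⁻¹ a b * frame ι ψ φ q a i * pd φ b f q := by
  choose c hc using fun J : Fin r → Fin m ↦ exists_bracketAt_cons hbr hφ (isOpen_dom hι)
    dom_subset hq fun k ↦ contMDiffOn_coordFun (φ := φ) hψ hι (J k)
  -- `K b` is the coefficient of `∂_b` in the derivation `f ↦ 𝒟^i(f)` at `q`; the factor `1 / √(r!)`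
  -- is the normalization in `bracketWith`.
  set K : Fin n → ℝ := fun b ↦ ε / γ q ^ 2 * ∑ I : Fin r → Fin m, ∑ J : Fin r → Fin m,
    bracketP ι ψ br i I q * (1 / √(r.factorial : ℝ) * c J b) * metricMulti η ψ I J (ι q) with hK
  have h1 : ∀ f : S → ℝ, ContMDiffOn (𝓡 n) 𝓘(ℝ, ℝ) ∞ f (dom ι ψ φ) →
      derivD η ι ψ br ε γ i f q = ∑ b, K b * pd φ b f q := by
    intro f hf
    simp only [derivD, bracketWith, hc _ f hf, hK, Finset.mul_sum, Finset.sum_mul]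
    refine (Finset.sum_congr rfl fun I _ ↦ Finset.sum_comm).trans ?_
    rw [Finset.sum_comm]
    refine Finset.sum_congr rfl fun b _ ↦ Finset.sum_congr rfl fun I _ ↦
      Finset.sum_congr rfl fun J _ ↦ ?_
    ring
  -- Testing on `f = x^j` gives `𝒟^{ij}`, known from compatibility; as `∂_b x^j` is the frame, its
  -- independence determines `K`.
  have h2 : K = fun b ↦ ∑ a, (inducedMat η ι ψ φ q)⁻¹ a b * frame ι ψ φ q a i := by
    refine eq_of_sum_frame_eq η hψ hφ hι hg hq fun j ↦ ?_
    refine (h1 (coordFun ι ψ j) (contMDiffOn_coordFun hψ hι j)).symm.trans ?_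
    refine (projD_eq η hψ hφ hε hγ hcompat hq i j).trans ?_
    rw [Finset.sum_comm]
    simp only [Finset.sum_mul]
  rw [h1 f hf, h2, Finset.sum_comm]
  simp only [Finset.sum_mul]

theorem contMDiffOn_inducedMat_inv (hψ : ψ ∈ IsManifold.maximalAtlas (𝓡 m) ∞ M)
    (hφ : φ ∈ IsManifold.maximalAtlas (𝓡 n) ∞ S) (hι : ContMDiff (𝓡 n) (𝓡 m) ∞ ι)
    (hg : InducedNondegenerate (n := n) η ι) (a b : Fin n) :
    ContMDiffOn (𝓡 n) 𝓘(ℝ, ℝ) ∞ (fun q ↦ (inducedMat η ι ψ φ q)⁻¹ a b) (dom ι ψ φ) := by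
  refine contMDiffOn_matrix_inv (fun a b ↦ ?_)
    (fun q hq ↦ inducedMat_det_ne_zero η hψ hφ hι hg hq) a b
  change ContMDiffOn (𝓡 n) 𝓘(ℝ, ℝ) ∞ (fun q ↦ ∑ i, ∑ j,
    metricMat η ψ (ι q) i j * frame ι ψ φ q a i * frame ι ψ φ q b j) (dom ι ψ φ)
  refine contMDiffOn_finsetSum fun i _ ↦ contMDiffOn_finsetSum fun j _ ↦ ?_
  exact (((contMDiffOn_metricMat η hψ i j).comp hι.contMDiffOn fun q hq ↦ hq.2).mul
    (contMDiffOn_frame hψ hφ hι a i)).mul (contMDiffOn_frame hψ hφ hι b j)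

/-- The `CoordFrame` of a submanifold over the ring of smooth functions on a coordinate domain. -/
def coordFrame (hψ : ψ ∈ IsManifold.maximalAtlas (𝓡 m) ∞ M)
    (hφ : φ ∈ IsManifold.maximalAtlas (𝓡 n) ∞ S) (hι : ContMDiff (𝓡 n) (𝓡 m) ∞ ι)
    (hg : InducedNondegenerate (n := n) η ι) : CoordFrame (SmoothOn n (dom ι ψ φ)) m n where
  D := SmoothOn.D hφ (isOpen_dom hι) dom_subset
  D_mul := SmoothOn.D_mul hφ (isOpen_dom hι) dom_subset
  D_comm := SmoothOn.D_comm hφ (isOpen_dom hι) dom_subset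
  G := Matrix.of fun i j ↦ SmoothOn.mk (fun q ↦ metricMat η ψ (ι q) i j)
    ((contMDiffOn_metricMat η hψ i j).comp hι.contMDiffOn fun q hq ↦ hq.2)
  G_symm i j := SmoothOn.ext_eval fun q ↦ metricMat_symm η (ι q) i j
  Γ i j k := SmoothOn.mk (fun q ↦ christoffel η ψ i j k (ι q))
    ((contMDiffOn_christoffel η hψ i j k).comp hι.contMDiffOn fun q hq ↦ hq.2)
  Γ_symm i j k := SmoothOn.ext_eval fun q ↦ christoffel_symm η i j k (ι q)
  e a i := SmoothOn.mk (fun q ↦ frame ι ψ φ q a i) (contMDiffOn_frame hψ hφ hι a i)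
  D_e a b i := by
    refine SmoothOn.ext_eval fun q ↦ ?_
    rw [← SmoothOn.pd_eq_eval_D hφ (isOpen_dom hι) dom_subset
        (F := fun q ↦ frame ι ψ φ q b i) (fun q ↦ rfl),
      ← SmoothOn.pd_eq_eval_D hφ (isOpen_dom hι) dom_subset
        (F := fun q ↦ frame ι ψ φ q a i) (fun q ↦ rfl)]
    exact pd_comm hφ (isOpen_dom hι) dom_subset (contMDiffOn_coordFun hψ hι i) q.2 a b
  D_G a i j := by
    refine SmoothOn.ext_eval fun q ↦ ?_
    rw [← SmoothOn.pd_eq_eval_D hφ (isOpen_dom hι) dom_subset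
        (F := fun q ↦ metricMat η ψ (ι q) i j) (fun q ↦ rfl),
      pd_comp hψ hφ hι q.2 (contMDiffOn_metricMat η hψ i j)]
    simp [pd_metricMat η hψ q.2.2]
  ginv := Matrix.of fun a b ↦ SmoothOn.mk (fun q ↦ (inducedMat η ι ψ φ q)⁻¹ a b)
    (contMDiffOn_inducedMat_inv η hψ hφ hι hg a b)
  ginv_mul := by
    refine Matrix.ext fun a b ↦ SmoothOn.ext_eval fun q ↦ ?_
    have h := congrFun (congrFun (Matrix.nonsing_inv_mul (inducedMat η ι ψ φ q)
      (inducedMat_det_ne_zero η hψ hφ hι hg q.2).isUnit) a) b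
    have h1 : SmoothOn.eval q ((1 : Matrix (Fin n) (Fin n) (SmoothOn n (dom ι ψ φ))) a b)
        = (1 : Matrix (Fin n) (Fin n) ℝ) a b := by
      by_cases hab : a = b <;> simp [Matrix.one_apply, hab]
    rw [h1, ← h]
    simp [Matrix.mul_apply, inducedMat, ip]

end Submanifold

/-! ### Geometric quantities as values of ring elements -/

section Models

variable {m n r : ℕ} {M : Type*} [TopologicalSpace M] [ChartedSpace (EuclideanSpace ℝ (Fin m)) M]
  [IsManifold (𝓡 m) ∞ M]
  {S : Type*} [TopologicalSpace S] [ChartedSpace (EuclideanSpace ℝ (Fin n)) S]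

/-- The components of a vector field along `ι` are given by elements of the ring of smooth
functions. -/
def Represents {W : Set S} (V : S → Fin m → ℝ) (v : Fin m → SmoothOn n W) : Prop :=
  ∀ (q : W) (i : Fin m), V q i = SmoothOn.eval q (v i)

/-- The components of `C` are the geometric quantities on the submanifold. -/
structure Models (η : PseudoMetric (m := m) M) (ι : S → M)
    (ψ : OpenPartialHomeomorph M (EuclideanSpace ℝ (Fin m)))
    (φ : OpenPartialHomeomorph S (EuclideanSpace ℝ (Fin n))) {W : Set S}
    (C : CoordFrame (SmoothOn n W) m n) : Prop where
  G : ∀ (q : W) i j, metricMat η ψ (ι q) i j = SmoothOn.eval q (C.G i j)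
  Γ : ∀ (q : W) i j k, christoffel η ψ i j k (ι q) = SmoothOn.eval q (C.Γ i j k)
  e : ∀ (q : W) a i, frame ι ψ φ q a i = SmoothOn.eval q (C.e a i)
  ginv : ∀ (q : W) a b, (inducedMat η ι ψ φ q)⁻¹ a b = SmoothOn.eval q (C.ginv a b)
  D : ∀ (F : S → ℝ) (f : SmoothOn n W), (∀ q : W, F q = SmoothOn.eval q f) →
    ∀ (q : W) a, pd φ a F q = SmoothOn.eval q (C.D a f)

theorem coordFrame_models {η : PseudoMetric (m := m) M} {ι : S → M}
    {ψ : OpenPartialHomeomorph M (EuclideanSpace ℝ (Fin m))}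
    {φ : OpenPartialHomeomorph S (EuclideanSpace ℝ (Fin n))}
    (hψ : ψ ∈ IsManifold.maximalAtlas (𝓡 m) ∞ M)
    (hφ : φ ∈ IsManifold.maximalAtlas (𝓡 n) ∞ S) (hι : ContMDiff (𝓡 n) (𝓡 m) ∞ ι)
    (hg : InducedNondegenerate (n := n) η ι) :
    Models η ι ψ φ (coordFrame η hψ hφ hι hg) where
  G _ _ _ := rfl
  Γ _ _ _ _ := rfl
  e _ _ _ := rfl
  ginv _ _ _ := rfl
  D _ _ h q a := SmoothOn.pd_eq_eval_D hφ (isOpen_dom hι) dom_subset h a q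

namespace Models

variable {η : PseudoMetric (m := m) M} {ι : S → M}
  {ψ : OpenPartialHomeomorph M (EuclideanSpace ℝ (Fin m))}
  {φ : OpenPartialHomeomorph S (EuclideanSpace ℝ (Fin n))} {W : Set S}
  {C : CoordFrame (SmoothOn n W) m n} (hC : Models η ι ψ φ C)
  {U V X Y Z : S → Fin m → ℝ} {u v x y z : Fin m → SmoothOn n W}

include hC

theorem ip_eq (hV : Represents V v) (hU : Represents U u) (q : W) :
    ip η ψ (ι q) (V q) (U q) = SmoothOn.eval q (C.metric v u) := by
  simp [ip, C.metric_apply, hC.G, hV q _, hU q _]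

theorem lower_eq (hV : Represents V v) (q : W) (i : Fin m) :
    lower η ψ (ι q) (V q) i = SmoothOn.eval q (C.low v i) := by
  simp [lower, CoordFrame.low, hC.G, hV q _]

theorem tanCoeff_eq (hV : Represents V v) (q : W) (a : Fin n) :
    tanCoeff η ι ψ φ V q a = SmoothOn.eval q (C.toFrameConnection.coef v a) := by
  simp [tanCoeff, FrameConnection.coef, ip, C.metric_apply, hC.G, hC.e, hC.ginv, hV q _]

theorem tanPart_represents (hV : Represents V v) :
    Represents (tanPart η ι ψ φ V) (C.toFrameConnection.vec (C.toFrameConnection.coef v)) := by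
  intro q i
  simp [tanPart, FrameConnection.vec, hC.tanCoeff_eq hV, hC.e]

theorem norPart_represents (hV : Represents V v) :
    Represents (norPart η ι ψ φ V) (C.toFrameConnection.nor v) := by
  intro q i
  simp [norPart, FrameConnection.nor, hC.tanPart_represents hV q i, hV q i]

theorem conn_eq (hV : Represents V v) (q : W) (a : Fin n) (i : Fin m) :
    pd φ a (fun p ↦ V p i) q
        + ∑ j, ∑ k, christoffel η ψ i j k (ι q) * frame ι ψ φ q a j * V q k
      = SmoothOn.eval q (C.conn a v i) := by
  rw [C.conn_apply, map_add, hC.D _ (v i) (fun q ↦ hV q i), Finset.sum_comm]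
  simp [CoordFrame.θ, hC.Γ, hC.e, hV q _, Finset.sum_mul]

theorem ambientDeriv_represents (hX : Represents X x)
    (hx : C.toFrameConnection.vec (C.toFrameConnection.coef x) = x) (hV : Represents V v) :
    Represents (ambientDeriv η ι ψ φ X V)
      (C.toFrameConnection.along (C.toFrameConnection.coef x) v) := by
  intro q i
  -- Tangency of `X` is needed for the Christoffel term, which uses the ambient components `X^j`, to
  -- agree with the derivative term, which uses the frame coefficients.
  have h1 : ∀ j, X q j = ∑ a, tanCoeff η ι ψ φ X q a * frame ι ψ φ q a j := by
    intro j
    rw [hX, ← hx]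
    simp [FrameConnection.vec, hC.tanCoeff_eq hX, hC.e]
  simp only [FrameConnection.along, Finset.sum_apply, Pi.smul_apply, smul_eq_mul, map_sum, map_mul,
    CoordFrame.toFrameConnection_conn, ← hC.conn_eq hV, ← hC.tanCoeff_eq hX, mul_add,
    Finset.sum_add_distrib, ambientDeriv, h1, Finset.mul_sum, Finset.sum_mul]
  congr 1
  refine (Finset.sum_congr rfl fun j _ ↦ Finset.sum_comm).trans ?_
  rw [Finset.sum_comm]
  congr! 3
  ring

theorem leviCivita_represents (hX : Represents X x)
    (hx : C.toFrameConnection.vec (C.toFrameConnection.coef x) = x) (hV : Represents V v) :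
    Represents (leviCivita η ι ψ φ X V) (C.toFrameConnection.vec (C.toFrameConnection.coef
      (C.toFrameConnection.along (C.toFrameConnection.coef x) v))) :=
  hC.tanPart_represents (hC.ambientDeriv_represents hX hx hV)

theorem secondForm_represents (hX : Represents X x)
    (hx : C.toFrameConnection.vec (C.toFrameConnection.coef x) = x) (hV : Represents V v) :
    Represents (secondForm η ι ψ φ X V)
      (C.toFrameConnection.nor (C.toFrameConnection.along (C.toFrameConnection.coef x) v)) :=
  hC.norPart_represents (hC.ambientDeriv_represents hX hx hV)

theorem secondFormDeriv_represents (hX : Represents X x)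
    (hx : C.toFrameConnection.vec (C.toFrameConnection.coef x) = x) (hY : Represents Y y)
    (hy : C.toFrameConnection.vec (C.toFrameConnection.coef y) = y) (hZ : Represents Z z) :
    Represents (secondFormDeriv η ι ψ φ X Y Z)
      (C.toFrameConnection.secondFormDeriv (C.toFrameConnection.coef x)
        (C.toFrameConnection.coef y) z) := by
  intro q i
  -- `D_X ξ` and the second fundamental form are given by the same formula, so this lemma also
  -- covers the normal derivative of `α(Y, Z)`.
  have h1 := hC.secondForm_represents hX hx (hC.secondForm_represents hY hy hZ) q i
  have h2 := hC.secondForm_represents (hC.leviCivita_represents hX hx hY)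
    (by rw [FrameConnection.coef_vec]) hZ q i
  have h3 := hC.secondForm_represents hY hy (hC.leviCivita_represents hX hx hZ) q i
  rw [FrameConnection.coef_vec] at h2
  rw [secondFormDeriv, h2, h3, normalDeriv]
  refine (congrArg (fun t ↦ t - _ - _) h1).trans ?_
  simp [FrameConnection.secondFormDeriv, hy]

theorem raise_eq (t : Fin n → SmoothOn n W) (q : W) (i : Fin m) :
    SmoothOn.eval q (C.raise t i)
      = ∑ a, ∑ b, (inducedMat η ι ψ φ q)⁻¹ a b * frame ι ψ φ q a i * SmoothOn.eval q (t b) := by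
  simp [CoordFrame.raise, hC.ginv, hC.e]

end Models

/-! ### Translation of the bracket operators, given `𝒟^i` and `𝒟^{ij}` in raised form -/

namespace Models

variable {η : PseudoMetric (m := m) M} {ι : S → M}
  {ψ : OpenPartialHomeomorph M (EuclideanSpace ℝ (Fin m))}
  {φ : OpenPartialHomeomorph S (EuclideanSpace ℝ (Fin n))} {W : Set S}
  {C : CoordFrame (SmoothOn n W) m n} (hC : Models η ι ψ φ C)
  {U V X Y Z : S → Fin m → ℝ} {u v x y z : Fin m → SmoothOn n W}
  {br : MultilinearMap ℝ (fun _ : Fin (r + 1) ↦ C^∞⟮𝓡 n, S; ℝ⟯) C^∞⟮𝓡 n, S; ℝ⟯}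
  {ε : ℝ} {γ : C^∞⟮𝓡 n, S; ℝ⟯}
  (hD : ∀ (F : S → ℝ) (f : SmoothOn n W), (∀ q : W, F q = SmoothOn.eval q f) →
    ∀ (q : W) i, derivD η ι ψ br ε γ i F q = SmoothOn.eval q (C.raise (fun b ↦ C.D b f) i))
  (hP : ∀ (q : W) i j,
    projD η ι ψ br ε γ i j q = SmoothOn.eval q (C.raise (fun b ↦ C.e b j) i))

include hC hD hP

/-- With `𝒟^j` and `𝒟^{jl}` both raised from the frame, the two summands combine to `g^{ab} e_a^j
∇̄_b V^i`. -/
theorem hatNabla_eq (hV : Represents V v) (q : W) (j i : Fin m) :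
    hatNabla η ι ψ br ε γ V j i q
      = SmoothOn.eval q (C.raise (fun b ↦ C.conn b v i) j) := by
  rw [hatNabla, hD _ (v i) (fun q ↦ hV q i)]
  simp only [hP, hC.Γ, hV q _, ← map_mul, ← map_sum, ← map_add]
  congr 1
  simp only [CoordFrame.raise, C.conn_apply, CoordFrame.θ, mul_add, Finset.sum_add_distrib,
    Finset.sum_mul, Finset.mul_sum]
  congr 1
  have h : ∀ f : Fin m → Fin m → Fin n → Fin n → SmoothOn n W,
      ∑ l, ∑ k, ∑ a, ∑ b, f l k a b = ∑ a, ∑ b, ∑ k, ∑ l, f l k a b := by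
    intro f
    simp only [← Fintype.sum_prod_type' (f := fun a b ↦ f _ _ a b)]
    rw [Finset.sum_comm, ← Fintype.sum_prod_type' (f := fun a b ↦ ∑ k, ∑ l, f l k a b),
      Finset.sum_comm]
    rw [Finset.sum_comm]
    refine (Finset.sum_congr rfl fun k _ ↦ Finset.sum_comm).trans ?_
    rw [Finset.sum_comm]
  rw [h]
  congr! 4
  ring

theorem hatDeriv_represents (hX : Represents X x) (hV : Represents V v) :
    Represents (hatDeriv η ι ψ br ε γ X V)
      (C.toFrameConnection.along (C.toFrameConnection.coef x) v) := by
  intro q i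
  simp only [hatDeriv, hC.lower_eq hX, hC.hatNabla_eq hD hP hV, ← map_mul, ← map_sum,
    C.sum_low_raise]
  simp [FrameConnection.along]

theorem tensorB_eq (hV : Represents V v) (q : W) (i j : Fin m) :
    tensorB η ι ψ br ε γ V i j q = SmoothOn.eval q (C.tensorB v i j) := by
  simp [tensorB, CoordFrame.tensorB, hC.hatNabla_eq hD hP hV]

theorem mapB_represents (hV : Represents V v) (hU : Represents U u) :
    Represents (mapB η ι ψ br ε γ V U) (C.mapB v u) := by
  intro q i
  simp [mapB, CoordFrame.mapB, hC.tensorB_eq hD hP hV, hC.lower_eq hU]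

theorem mapBDeriv_represents (hV : Represents V v) (hX : Represents X x) (hU : Represents U u) :
    Represents (mapBDeriv η ι ψ br ε γ V X U)
      (C.toFrameConnection.along (C.toFrameConnection.coef x) (C.mapB v u)
        - C.mapB v (C.toFrameConnection.along (C.toFrameConnection.coef x) u)) := by
  intro q i
  simp [mapBDeriv, hC.hatDeriv_represents hD hP hX (hC.mapB_represents hD hP hV hU) q i,
    hC.mapB_represents hD hP hV (hC.hatDeriv_represents hD hP hX hU) q i]

theorem hatNabla₂_eq {T : Fin m → Fin m → S → ℝ} {t : Fin m → Fin m → SmoothOn n W}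
    (hT : ∀ (q : W) i j, T i j q = SmoothOn.eval q (t i j)) (q : W) (k i j : Fin m) :
    hatNabla₂ η ι ψ br ε γ T k i j q = SmoothOn.eval q (C.hatConn₂ t k i j) := by
  rw [hatNabla₂, hD _ (t i j) (fun q ↦ hT q i j)]
  simp only [hP, hC.Γ, hT q, ← map_mul, ← map_sum, ← map_add]
  congr 1
  simp only [CoordFrame.hatConn₂, CoordFrame.raise, CoordFrame.conn₂, mul_add,
    Finset.sum_add_distrib, Finset.sum_mul, Finset.mul_sum]
  have h : ∀ f : Fin m → Fin m → Fin n → Fin n → SmoothOn n W,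
      ∑ l, ∑ k, ∑ a, ∑ b, f l k a b = ∑ a, ∑ b, ∑ l, ∑ k, f l k a b := by
    intro f
    simp only [← Fintype.sum_prod_type' (f := fun a b ↦ f _ _ a b)]
    rw [← Fintype.sum_prod_type' (f := fun a b ↦ ∑ l, ∑ k, f l k a b)]
    refine (Finset.sum_congr rfl fun k _ ↦ Finset.sum_comm).trans ?_
    rw [Finset.sum_comm]
  rw [h, h]
  simp only [mul_assoc, mul_left_comm, mul_comm]

end Models

end Models

/-! ### The curvature of `M` along the submanifold -/

section Curvature

variable {m n r : ℕ} {M : Type*} [TopologicalSpace M] [ChartedSpace (EuclideanSpace ℝ (Fin m)) M]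
  [IsManifold (𝓡 m) ∞ M] (η : PseudoMetric (m := m) M)
  {S : Type*} [TopologicalSpace S] [ChartedSpace (EuclideanSpace ℝ (Fin n)) S]
  {ι : S → M} {ψ : OpenPartialHomeomorph M (EuclideanSpace ℝ (Fin m))}
  {φ : OpenPartialHomeomorph S (EuclideanSpace ℝ (Fin n))}

/-- The `dΓ` of `riem_eq` are the ambient partial derivatives of the Christoffel symbols restricted
along `ι`; `pd_comp` supplies the required chain rule. -/
theorem riemann_represents (hψ : ψ ∈ IsManifold.maximalAtlas (𝓡 m) ∞ M)
    (hφ : φ ∈ IsManifold.maximalAtlas (𝓡 n) ∞ S) (hι : ContMDiff (𝓡 n) (𝓡 m) ∞ ι)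
    (hg : InducedNondegenerate (n := n) η ι) {X Y Z : S → Fin m → ℝ}
    {C : CoordFrame (SmoothOn n (dom ι ψ φ)) m n} (hC : C = coordFrame η hψ hφ hι hg)
    {x y z : Fin m → SmoothOn n (dom ι ψ φ)}
    (hX : Represents X x) (hx : C.toFrameConnection.vec (C.toFrameConnection.coef x) = x)
    (hY : Represents Y y) (hy : C.toFrameConnection.vec (C.toFrameConnection.coef y) = y)
    (hZ : Represents Z z) :
    Represents (fun q ↦ riemann η ψ (ι q) (X q) (Y q) (Z q))
      (C.toFrameConnection.riem (C.toFrameConnection.coef x) (C.toFrameConnection.coef y) z) := by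
  have hs : ∀ l i j k, ContMDiffOn (𝓡 n) 𝓘(ℝ, ℝ) ∞
      (fun q ↦ pd ψ l (christoffel η ψ i j k) (ι q)) (dom ι ψ φ) := fun l i j k ↦
    (contMDiffOn_pd hψ ψ.open_source subset_rfl (contMDiffOn_christoffel η hψ i j k) l).comp
      hι.contMDiffOn fun q hq ↦ hq.2
  have hΓ : ∀ a i j k, C.D a (C.Γ i j k) = ∑ l, C.e a l * SmoothOn.mk _ (hs l i j k) := by
    intro a i j k
    refine SmoothOn.ext_eval fun q ↦ ?_
    subst hC
    rw [← (coordFrame_models hψ hφ hι hg).D (fun q ↦ christoffel η ψ i j k (ι q)) _ (fun q ↦ rfl),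
      pd_comp hψ hφ hι q.2 (contMDiffOn_christoffel η hψ i j k)]
    simp [(coordFrame_models hψ hφ hι hg).e]
  have hM : Models η ι ψ φ C := by
    rw [hC]
    exact coordFrame_models hψ hφ hι hg
  intro q l
  rw [C.riem_eq hΓ, hx, hy]
  simp [riemann, curvature, CoordFrame.R, hX q _, hY q _, hZ q _, hM.Γ]

end Curvature

end PseudoSub

end

/-! ### The Codazzi equations on the manifold -/

theorem mainTheorem7 {m n r : ℕ}
    {M : Type*} [TopologicalSpace M] [ChartedSpace (EuclideanSpace ℝ (Fin m)) M]
    [IsManifold (𝓡 m) ∞ M] (η : PseudoSub.PseudoMetric (m := m) M)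
    {S : Type*} [TopologicalSpace S] [T2Space S] [ChartedSpace (EuclideanSpace ℝ (Fin n)) S]
    [IsManifold (𝓡 n) ∞ S]
    (ι : S → M) (hι : ContMDiff (𝓡 n) (𝓡 m) ∞ ι) (hg : PseudoSub.InducedNondegenerate (n := n) η ι)
    (br : MultilinearMap ℝ (fun _ : Fin (r + 1) ↦ C^∞⟮𝓡 n, S; ℝ⟯) C^∞⟮𝓡 n, S; ℝ⟯)
    (hbr : PseudoSub.IsMultiDerivation br)
    (ε : ℝ) (hε : ε = 1 ∨ ε = -1) (γ : C^∞⟮𝓡 n, S; ℝ⟯) (hγ : ∀ p, 0 < γ p)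
    (hcompat : PseudoSub.IsCompatible η ι br ε γ)
    (X Y Z N : ∀ p : S, TangentSpace (𝓡 m) (ι p))
    (hX : PseudoSub.IsSmoothAlong (n := n) ι X) (hXt : PseudoSub.IsTangent (n := n) ι X)
    (hY : PseudoSub.IsSmoothAlong (n := n) ι Y) (hYt : PseudoSub.IsTangent (n := n) ι Y)
    (hZ : PseudoSub.IsSmoothAlong (n := n) ι Z) (hZt : PseudoSub.IsTangent (n := n) ι Z)
    (hN : PseudoSub.IsSmoothAlong (n := n) ι N) (hNn : PseudoSub.IsNormal (n := n) η ι N)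
    (ψ : OpenPartialHomeomorph M (EuclideanSpace ℝ (Fin m)))
    (hψ : ψ ∈ IsManifold.maximalAtlas (𝓡 m) ∞ M)
    (φ : OpenPartialHomeomorph S (EuclideanSpace ℝ (Fin n)))
    (hφ : φ ∈ IsManifold.maximalAtlas (𝓡 n) ∞ S)
    (p : S) (hp : p ∈ φ.source) (hιp : ι p ∈ ψ.source) :
    let x := PseudoSub.comps ι ψ X
    let y := PseudoSub.comps ι ψ Y
    let z := PseudoSub.comps ι ψ Z
    let ν := PseudoSub.comps ι ψ N
    let B := PseudoSub.tensorB η ι ψ br ε γ ν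
    let normalCurvature :=
      PseudoSub.ip η ψ (ι p) (PseudoSub.riemann η ψ (ι p) (x p) (y p) (z p)) (ν p)
    normalCurvature =
        ∑ i, ∑ j, ∑ l, PseudoSub.lower η ψ (ι p) (x p) i * PseudoSub.lower η ψ (ι p) (y p) j *
          PseudoSub.lower η ψ (ι p) (z p) l *
          (PseudoSub.hatNabla₂ η ι ψ br ε γ B i j l p
            - PseudoSub.hatNabla₂ η ι ψ br ε γ B j i l p) ∧
      normalCurvature =
        PseudoSub.ip η ψ (ι p) (PseudoSub.mapBDeriv η ι ψ br ε γ ν x z p) (y p)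
          - PseudoSub.ip η ψ (ι p) (PseudoSub.mapBDeriv η ι ψ br ε γ ν y z p) (x p) ∧
      normalCurvature =
        PseudoSub.ip η ψ (ι p)
          (fun i ↦ PseudoSub.secondFormDeriv η ι ψ φ x y z p i
            - PseudoSub.secondFormDeriv η ι ψ φ y x z p i) (ν p) := by
  intro x y z ν B normalCurvature
  have hpW : p ∈ PseudoSub.dom ι ψ φ := ⟨hp, hιp⟩
  obtain ⟨C, hCdef⟩ : ∃ C, C = PseudoSub.coordFrame η hψ hφ hι hg := ⟨_, rfl⟩
  have hC : PseudoSub.Models η ι ψ φ C := hCdef ▸ PseudoSub.coordFrame_models hψ hφ hι hg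
  have hrep : ∀ V : ∀ p : S, TangentSpace (𝓡 m) (ι p), PseudoSub.IsSmoothAlong (n := n) ι V →
      ∃ v : Fin m → PseudoSub.SmoothOn n (PseudoSub.dom ι ψ φ),
        PseudoSub.Represents (PseudoSub.comps ι ψ V) v := fun V hV ↦
    ⟨fun i ↦ PseudoSub.SmoothOn.mk _ (PseudoSub.contMDiffOn_comps hψ hV i), fun _ _ ↦ rfl⟩
  have htan : ∀ (V : ∀ p : S, TangentSpace (𝓡 m) (ι p))
      (v : Fin m → PseudoSub.SmoothOn n (PseudoSub.dom ι ψ φ)),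
      PseudoSub.Represents (PseudoSub.comps ι ψ V) v → PseudoSub.IsTangent (n := n) ι V →
      C.toFrameConnection.vec (C.toFrameConnection.coef v) = v := by
    intro V v hv hV
    funext i
    refine PseudoSub.SmoothOn.ext_eval fun q ↦ ?_
    obtain ⟨c, hc⟩ := PseudoSub.comps_eq_of_isTangent hψ hφ hι q.2 hV
    rw [← hC.tanPart_represents hv q i, ← hv q i, hc,
      PseudoSub.tanPart_eq_self η hψ hφ hι hg q.2 hc]
  obtain ⟨x', hx'⟩ := hrep X hX
  obtain ⟨y', hy'⟩ := hrep Y hY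
  obtain ⟨z', hz'⟩ := hrep Z hZ
  obtain ⟨ν', hν'⟩ := hrep N hN
  have hxt := htan X x' hx' hXt
  have hyt := htan Y y' hy' hYt
  have hνn : ∀ a, C.metric (C.e a) ν' = 0 := by
    intro a
    refine PseudoSub.SmoothOn.ext_eval fun q ↦ ?_
    rw [← hC.ip_eq (V := fun q ↦ PseudoSub.frame ι ψ φ q a) (fun q i ↦ hC.e q a i) hν',
      PseudoSub.ip_frame_comps_of_isNormal η hψ hφ hι q.2 hNn, map_zero]
  have hD : ∀ (F : S → ℝ) (f : PseudoSub.SmoothOn n (PseudoSub.dom ι ψ φ)),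
      (∀ q : PseudoSub.dom ι ψ φ, F q = PseudoSub.SmoothOn.eval q f) →
      ∀ (q : PseudoSub.dom ι ψ φ) i, PseudoSub.derivD η ι ψ br ε γ i F q
        = PseudoSub.SmoothOn.eval q (C.raise (fun b ↦ C.D b f) i) := by
    intro F f h q i
    rw [hC.raise_eq, PseudoSub.derivD_eq η hψ hφ hι hg hbr hε hγ hcompat q.2 i
      (PseudoSub.SmoothOn.contMDiffOn_of_eval f h)]
    simp only [hC.D F f h]
  have hP : ∀ (q : PseudoSub.dom ι ψ φ) i j, PseudoSub.projD η ι ψ br ε γ i j q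
      = PseudoSub.SmoothOn.eval q (C.raise (fun b ↦ C.e b j) i) := by
    intro q i j
    rw [hC.raise_eq, PseudoSub.projD_eq η hψ hφ hε hγ hcompat q.2]
    simp only [hC.e]
  -- The common value of all the expressions, as an element of the ring evaluated at `p`.
  have hcurv : normalCurvature = PseudoSub.SmoothOn.eval ⟨p, hpW⟩
      (C.metric (C.toFrameConnection.riem (C.toFrameConnection.coef x')
        (C.toFrameConnection.coef y') z') ν') :=
    hC.ip_eq (PseudoSub.riemann_represents η hψ hφ hι hg hCdef hx' hxt hy' hyt hz') hν' ⟨p, hpW⟩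
  refine ⟨?_, ?_, ?_⟩
  · rw [hcurv, ← C.codazzi_tensorB hxt hyt]
    have hB : ∀ (q : PseudoSub.dom ι ψ φ) i j, B i j q
        = PseudoSub.SmoothOn.eval q (C.tensorB ν' i j) := hC.tensorB_eq hD hP hν'
    simp only [map_sum, map_mul, map_sub, ← hC.hatNabla₂_eq hD hP hB, ← hC.lower_eq hx',
      ← hC.lower_eq hy', ← hC.lower_eq hz']
    rfl
  · rw [hcurv, ← C.codazzi_mapB hxt hyt, map_sub,
      ← hC.ip_eq (hC.mapBDeriv_represents hD hP hν' hx' hz') hy',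
      ← hC.ip_eq (hC.mapBDeriv_represents hD hP hν' hy' hz') hx']
  · have h := C.toFrameConnection.metric_secondFormDeriv_sub hνn (C.toFrameConnection.coef x')
      (C.toFrameConnection.coef y') z'
    rw [PseudoSub.CoordFrame.toFrameConnection_metric] at h
    rw [hcurv, ← h]
    refine (hC.ip_eq (V := fun q i ↦ PseudoSub.secondFormDeriv η ι ψ φ x y z q i
      - PseudoSub.secondFormDeriv η ι ψ φ y x z q i) (fun q i ↦ ?_) hν' ⟨p, hpW⟩).symm
    exact (congrArg₂ (· - ·) (hC.secondFormDeriv_represents hx' hxt hy' hyt hz' q i)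
      (hC.secondFormDeriv_represents hy' hyt hx' hxt hz' q i)).trans (map_sub _ _ _).symm
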